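/- Let $(\Omega,\mathcal F,\mathbb P)$ be a probability space and $\mathcal G\subseteq\mathcal F$ a sub-$\sigma$-algebra such that $(\Omega,\mathcal G,\mathbb P)$ is atomless, i.e. $\{\mathbb P(A):A\subseteq B,\ A\in\mathcal G\}=[0,\mathbb P(B)]$ for all $B\in\mathcal G$. Write $L^\infty=L^\infty(\Omega,\mathcal F,\mathbb P)$, let $L^0(\mathcal G)$ (resp. $L^\infty(\mathcal G)$) be the set of (resp. essentially bounded) $\mathcal G$-measurable random variables modulo $\mathbb P$-a.s. equality, and let $X\overset{\mathrm d}{=}Y$ mean equality in distribution under $\mathbb P$. Let $\mathcal M(\mathcal G)$ (resp. $\mathcal M_1(\mathcal G)$) be the set of finite signed (resp. probability) measures on $(\Omega,\mathcal G)$ that are absolutely continuous with respect to $\mathbb P|_{\mathcal G}$; for $\mu\in\mathcal M(\mathcal G)$ let $D_\mu=\mathrm d\mu/\mathrm d\mathbb P|_{\mathcal G}$ and $\mathbb E^\mu[X]=\mathbb E[D_\mu X]$ for $X\in L^\infty$. A map $f:L^\infty\to[-\infty,\infty)$ is Fatou if $f(X)\le\liminf_n f(X_n)$ for every uniformly bounded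 sequence $(X_n)$ in $L^\infty$ converging $\mathbb P$-a.s. to $X\in L^\infty$. A convex risk measure is a map $\rho:L^\infty\to\mathbb R$ that is cash invariant ($\rho(X+c)=\rho(X)+c$ for $c\in\mathbb R$), monotone ($X\le Y$ implies $\rho(X)\le\rho(Y)$) and convex. For $\mu\in\mathcal M_1(\mathcal G)$, a $\mu$-convex adjustment is either the map $\tau\equiv-\infty$ on $L^\infty$, or a convex map $\tau:L^\infty\to\mathbb R$ such that $\tau(X+Y)=\tau(X)$ for all $X\in L^\infty$, $Y\in L^\infty(\mathcal G)$, and $\mathbb E^\mu[X]+\tau(X)\le\mathbb E^\mu[Y]+\tau(Y)$ whenever $X\le Y$ in $L^\infty$. A CoA-assignment is a family $(\tau_\mu)_{\mu\in\mathcal M_1(\mathcal G)}$ in which each $\tau_\mu$ is a Fatou $\mu$-convex adjustment and $\mu\mapsto\tau_\mu(0)\in[-\infty,\infty)$ is concave. A map $\rho:L^\infty\to\mathbb R$ is $\mathcal G$-law invariant if $\rho(X)=\rho(Y)$ for all $X,Y\in L^\infty(\mathcal G)$ with $X\overset{\mathrm d}{=}Y$. A set $\mathcal S\subseteq\mathcal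 M_1(\mathcal G)$ is almost $\mathcal G$-law invariant if its closure $\overline{\mathcal S}$ in $\mathcal M(\mathcal G)$, for the coarsest topology making $\mu\mapsto\mathbb E^\mu[Y]$ continuous for every $Y\in L^\infty(\mathcal G)$, has the property that $\mu\in\overline{\mathcal S}$, $Y\in L^0(\mathcal G)$ and $D_\mu\overset{\mathrm d}{=}Y$ imply $Y=D_\nu$ for some $\nu\in\overline{\mathcal S}$. Theorem. A mapping $\rho:L^\infty\to\mathbb R$ is a Fatou convex risk measure if and only if there exists a CoA-assignment $(\tau_\mu)_{\mu\in\mathcal M_1(\mathcal G)}$ such that $$\rho(X)=\sup_{\mu\in\mathcal M_1(\mathcal G)}\bigl(\mathbb E^\mu[X]+\tau_\mu(X)\bigr),\qquad X\in L^\infty.\tag{$*$}$$ Moreover, for every CoA-assignment $(\tau_\mu)$ satisfying $(*)$, $\rho$ is $\mathcal G$-law invariant if and only if for every real $c>-\rho(0)$ the set $\{\mu\in\mathcal M_1(\mathcal G):-\tau_\mu(0)\le c\}$ is almost $\mathcal G$-law invariant. -/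

import Mathlib

open MeasureTheory ProbabilityTheory Filter Topology
open scoped ENNReal

noncomputable section

namespace PartialLaw

/-- The space `L^∞` of (classes of) essentially bounded random variables. -/
abbrev Linf {Ω : Type*} {mΩ : MeasurableSpace Ω} (P : Measure Ω) : Type _ := Lp ℝ ⊤ P

/-- The subspace `L^∞(𝒢)` of those elements of `L^∞` that have a `𝒢`-measurable version. -/
abbrev LinfSub {Ω : Type*} (G : MeasurableSpace Ω) {mΩ : MeasurableSpace Ω} (P : Measure Ω) :
    Submodule ℝ (Linf P) := lpMeas ℝ ℝ G ⊤ P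

/-- `(Ω, 𝒢, P)` is atomless: for every `B ∈ 𝒢`, the values `P A` with `A ⊆ B`, `A ∈ 𝒢`
fill the whole interval `[0, P B]`. -/
def Atomless {Ω : Type*} (G : MeasurableSpace Ω) {mΩ : MeasurableSpace Ω} (P : Measure Ω) : Prop :=
  ∀ B : Set Ω, MeasurableSet[G] B →
    {p : ℝ≥0∞ | ∃ A : Set Ω, A ⊆ B ∧ MeasurableSet[G] A ∧ P A = p} = Set.Icc 0 (P B)

/-! ### Measures on `𝒢` that are absolutely continuous with respect to `P|𝒢` -/

/-- The vector space `ℳ(𝒢)` of finite signed measures on `(Ω, 𝒢)` that are absolutely continuous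
with respect to the restriction of `P` to `𝒢`. -/
def ACMeasures {Ω : Type*} {G mΩ : MeasurableSpace Ω} (P : Measure Ω) (hG : G ≤ mΩ) :
    Submodule ℝ (@SignedMeasure Ω G) where
  carrier := {μ | μ ≪ᵥ (P.trim hG).toENNRealVectorMeasure}
  zero_mem' := VectorMeasure.AbsolutelyContinuous.zero _
  add_mem' h₁ h₂ := h₁.add h₂
  smul_mem' _ _ h := h.smul

/-- The set `ℳ₁(𝒢)` of probability measures in `ℳ(𝒢)`. -/
def ACProb {Ω : Type*} {G mΩ : MeasurableSpace Ω} (P : Measure Ω) (hG : G ≤ mΩ) :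
    Set (ACMeasures P hG) :=
  {μ | (∀ A : Set Ω, MeasurableSet[G] A → 0 ≤ (μ : @SignedMeasure Ω G) A) ∧
    (μ : @SignedMeasure Ω G) Set.univ = 1}

/-- The Radon–Nikodym derivative `D_μ` of `μ ∈ ℳ(𝒢)` with respect to `P|𝒢`. -/
def density {Ω : Type*} {G mΩ : MeasurableSpace Ω} {P : Measure Ω} {hG : G ≤ mΩ}
    (μ : ACMeasures P hG) : Ω → ℝ :=
  SignedMeasure.rnDeriv (μ : @SignedMeasure Ω G) (P.trim hG)

theorem aestronglyMeasurable_density {Ω : Type*} {G mΩ : MeasurableSpace Ω} {P : Measure Ω}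
    {hG : G ≤ mΩ} (μ : ACMeasures P hG) : AEStronglyMeasurable (density μ) P :=
  ((SignedMeasure.measurable_rnDeriv (μ : @SignedMeasure Ω G) (P.trim hG)).mono hG
    le_rfl).aestronglyMeasurable

/-- `D_μ` as an element of `L^0`. -/
def densityClass {Ω : Type*} {G mΩ : MeasurableSpace Ω} {P : Measure Ω} {hG : G ≤ mΩ}
    (μ : ACMeasures P hG) : Ω →ₘ[P] ℝ :=
  AEEqFun.mk (density μ) (aestronglyMeasurable_density μ)

/-- `E^μ[X] = E[D_μ X]` for `μ ∈ ℳ(𝒢)` and `X ∈ L^∞`. -/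
def expect {Ω : Type*} {G mΩ : MeasurableSpace Ω} {P : Measure Ω} {hG : G ≤ mΩ}
    (μ : ACMeasures P hG) (X : Linf P) : ℝ :=
  ∫ ω, density μ ω * X ω ∂P

/-- The weak topology `w(ℳ(𝒢), L^∞(𝒢))`: the coarsest topology on `ℳ(𝒢)` that makes all the
functionals `μ ↦ E^μ[Y]`, `Y ∈ L^∞(𝒢)`, continuous. -/
abbrev weakTopology {Ω : Type*} {G mΩ : MeasurableSpace Ω} (P : Measure Ω) (hG : G ≤ mΩ) :
    TopologicalSpace (ACMeasures P hG) :=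
  TopologicalSpace.induced
    (fun (μ : ACMeasures P hG) (Y : LinfSub G P) => expect μ (Y : Linf P)) Pi.topologicalSpace

/-! ### Law invariance -/

/-- A functional `ρ` on `L^∞` is `𝒢`-law invariant. -/
def LawInvariant {Ω : Type*} (G : MeasurableSpace Ω) {mΩ : MeasurableSpace Ω} {P : Measure Ω}
    (ρ : Linf P → ℝ) : Prop :=
  ∀ X ∈ LinfSub G P, ∀ Y ∈ LinfSub G P, IdentDistrib X Y P P → ρ X = ρ Y

/-- A subset of `L^0` is `𝒢`-law invariant. -/
def LawInvariantSet {Ω : Type*} (G : MeasurableSpace Ω) {mΩ : MeasurableSpace Ω} {P : Measure Ω}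
    (S : Set (Ω →ₘ[P] ℝ)) : Prop :=
  ∀ X ∈ S, AEStronglyMeasurable[G] X P → ∀ Y : Ω →ₘ[P] ℝ, AEStronglyMeasurable[G] Y P →
    IdentDistrib X Y P P → Y ∈ S

/-- A set `S` of measures is almost `𝒢`-law invariant if the set of densities of the elements of
its `w(ℳ(𝒢), L^∞(𝒢))`-closure is `𝒢`-law invariant. -/
def AlmostLawInvariant {Ω : Type*} {G mΩ : MeasurableSpace Ω} {P : Measure Ω} {hG : G ≤ mΩ}
    (S : Set (ACMeasures P hG)) : Prop :=
  LawInvariantSet G (densityClass '' (closure[weakTopology P hG] S))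

/-! ### Fatou convex risk measures and convex adjustments -/

/-- Fatou continuity: lower semicontinuity along uniformly bounded a.s. convergent sequences. -/
def Fatou {Ω : Type*} {mΩ : MeasurableSpace Ω} {P : Measure Ω} (f : Linf P → EReal) : Prop :=
  ∀ (Xs : ℕ → Linf P) (X : Linf P), (∃ M : ℝ, ∀ n, ‖Xs n‖ ≤ M) →
    (∀ᵐ ω ∂P, Tendsto (fun n => Xs n ω) atTop (𝓝 (X ω))) →
    f X ≤ liminf (fun n => f (Xs n)) atTop

/-- Convex risk measures on `L^∞` (losses are counted positively). -/
structure IsConvexRiskMeasure {Ω : Type*} {mΩ : MeasurableSpace Ω} {P : Measure Ω}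
    [IsFiniteMeasure P] (ρ : Linf P → ℝ) : Prop where
  cash_invariant : ∀ (X : Linf P) (c : ℝ), ρ (X + Lp.const ⊤ P c) = ρ X + c
  monotone : ∀ X Y : Linf P, X ≤ Y → ρ X ≤ ρ Y
  convex : ∀ (X Y : Linf P) (l : ℝ), 0 ≤ l → l ≤ 1 →
    ρ (l • X + (1 - l) • Y) ≤ l * ρ X + (1 - l) * ρ Y

/-- The three defining properties of a real-valued `μ`-convex adjustment. -/
structure IsRealConvexAdjustment {Ω : Type*} {G mΩ : MeasurableSpace Ω} {P : Measure Ω}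
    {hG : G ≤ mΩ} (μ : ACMeasures P hG) (t : Linf P → ℝ) : Prop where
  invariant : ∀ X : Linf P, ∀ Y ∈ LinfSub G P, t (X + Y) = t X
  monotone : ∀ X Y : Linf P, X ≤ Y → expect μ X + t X ≤ expect μ Y + t Y
  convex : ∀ (X Y : Linf P) (l : ℝ), 0 ≤ l → l ≤ 1 →
    t (l • X + (1 - l) • Y) ≤ l * t X + (1 - l) * t Y

/-- A `μ`-convex adjustment: either real-valued with the three properties above, or identically
`-∞`. -/
def IsConvexAdjustment {Ω : Type*} {G mΩ : MeasurableSpace Ω} {P : Measure Ω} {hG : G ≤ mΩ}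
    (μ : ACMeasures P hG) (τ : Linf P → EReal) : Prop :=
  (∃ t : Linf P → ℝ, IsRealConvexAdjustment μ t ∧ ∀ X, τ X = ((t X : ℝ) : EReal)) ∨
    ∀ X, τ X = ⊥

/-- CoA-assignments: a Fatou `μ`-convex adjustment `τ_μ` for every `μ ∈ ℳ₁(𝒢)`, such that
`μ ↦ τ_μ(0)` is concave (as a map into `[-∞, ∞)`, with `0 * (-∞) = 0`). -/
structure IsCoAAssignment {Ω : Type*} {G mΩ : MeasurableSpace Ω} {P : Measure Ω} {hG : G ≤ mΩ}
    (τ : ACProb P hG → Linf P → EReal) : Prop where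
  adjustment : ∀ μ : ACProb P hG, IsConvexAdjustment (μ : ACMeasures P hG) (τ μ)
  fatou : ∀ μ : ACProb P hG, Fatou (τ μ)
  concave : ∀ (μ₁ μ₂ υ : ACProb P hG) (l : ℝ), 0 ≤ l → l ≤ 1 →
    (υ : ACMeasures P hG) = l • (μ₁ : ACMeasures P hG) + (1 - l) • (μ₂ : ACMeasures P hG) →
    (l : EReal) * τ μ₁ 0 + ((1 - l : ℝ) : EReal) * τ μ₂ 0 ≤ τ υ 0

/-- `ρ(X) = sup_{μ ∈ ℳ₁(𝒢)} (E^μ[X] + τ_μ(X))` for all `X ∈ L^∞`. -/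
def Represents {Ω : Type*} {G mΩ : MeasurableSpace Ω} {P : Measure Ω} {hG : G ≤ mΩ}
    (τ : ACProb P hG → Linf P → EReal) (ρ : Linf P → ℝ) : Prop :=
  ∀ X : Linf P, ((ρ X : ℝ) : EReal) =
    ⨆ μ : ACProb P hG, ((expect (μ : ACMeasures P hG) X : ℝ) : EReal) + τ μ X

end PartialLaw

end

/-! The representation is the classical dual one, with the minorants sorted by what they do on 𝒢.
The acceptance set {ρ ≤ 0} is convex and closed under bounded a.s. limits, so
`exists_pairing_separating` separates it from any outside point by some Z ∈ L¹. Hence ρ is the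
supremum of its affine minorants X ↦ E[ZX] − a (`IsConvexRiskMeasure.exists_affine_minorant`);
monotonicity and cash invariance force Z to be a probability density. Grouping the pairs (Z, a) by
the restriction μ of Z·P to 𝒢 gives τ_μ(X) = sup (E[ZX] − a − E^μ[X]), which is `excess`. Adding Y ∈
L^∞(𝒢) to X changes nothing since Z and μ agree on Y, and μ ↦ τ_μ(0) is concave since minorants can
be mixed. Conversely, the properties of a Fatou convex risk measure pass to the supremum (*).

The separation is a Krein–Šmulian argument: bounded parts of the set are weak-* compact, as one sees
inside L², and the separating functional is assembled as an ℓ¹ combination of elements of L¹.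

For law invariance, τ_μ is constant on L^∞(𝒢), so there ρ is the convex conjugate of the penalty μ ↦
−τ_μ(0). For c > −ρ(0), a Fenchel–Moreau argument identifies the closure of {−τ_μ(0) ≤ c} with {ν :
E^ν[Y] ≤ ρ(Y) + c for all Y ∈ L^∞(𝒢)} (`expect_le_of_mem_sublevel`, `expect_le_of_mem_closure`,
`mem_closure_sublevel`). Both implications then use `Atomless.exists_identDistrib_integral_mul_ge`:
if f' is a copy of f, some copy g' of g satisfies E[f'g'] ≥ E[fg] − ε. An exact joint copy may fail
to exist, for instance when f' generates 𝒢 and f does not; rounding f and f' to a grid avoids this.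
-/

noncomputable section

namespace PartialLaw

open scoped ZeroAtInfty

/-! ### The Krein–Šmulian theorem -/

/-- Every continuous functional on `c₀(ι)` is given by an absolutely summable family. -/
theorem exists_summable_of_dual_zeroAtInfty {ι : Type*} [TopologicalSpace ι] [DiscreteTopology ι]
    (φ : C₀(ι, ℝ) →L[ℝ] ℝ) :
    ∃ l : ι → ℝ, Summable (fun i => |l i|) ∧
      ∀ x : C₀(ι, ℝ), HasSum (fun i => l i * x i) (φ x) := by
  classical
  let e : ι → C₀(ι, ℝ) := fun i =>
    ⟨⟨Pi.single i (1 : ℝ), continuous_of_discreteTopology⟩, by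
      rw [cocompact_eq_cofinite]
      refine tendsto_const_nhds.congr' ?_
      filter_upwards [(Set.finite_singleton i).compl_mem_cofinite] with j hj
      have : j ≠ i := hj
      simp [this]⟩
  have he : ∀ i j, e i j = if j = i then 1 else 0 := fun i j => by
    change (Pi.single i (1 : ℝ) : ι → ℝ) j = _
    rw [Pi.single_apply]
  have hcoe : ∀ (s : Finset ι) (f : ι → C₀(ι, ℝ)) (j : ι), (∑ i ∈ s, f i) j = ∑ i ∈ s, f i j := by
    intro s f j
    induction s using Finset.induction_on with
    | empty => simp
    | insert a s ha ih => simp [Finset.sum_insert ha, ih]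
  have hsum : ∀ (s : Finset ι) (c : ι → ℝ) (j : ι),
      (∑ i ∈ s, c i • e i) j = if j ∈ s then c j else 0 := by
    intro s c j
    rw [hcoe]
    simp [he]
  have hnorm : ∀ (x : C₀(ι, ℝ)) (r : ℝ), 0 ≤ r → (∀ i, |x i| ≤ r) → ‖x‖ ≤ r := by
    intro x r hr h
    rw [← ZeroAtInftyContinuousMap.norm_toBCF_eq_norm, BoundedContinuousFunction.norm_le hr]
    exact h
  refine ⟨fun i => φ (e i), ?_, fun x => ?_⟩
  · refine summable_of_sum_le (c := ‖φ‖) (fun i => abs_nonneg _) fun s => ?_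
    -- The vector of signs on `s` has sup norm at most 1, so `‖φ‖` bounds every partial sum.
    have h1 : ∑ i ∈ s, |φ (e i)| = φ (∑ i ∈ s, (SignType.sign (φ (e i)) : ℝ) • e i) := by
      simp only [map_sum, map_smul, smul_eq_mul]
      exact Finset.sum_congr rfl fun i _ => (sign_mul_self _).symm
    rw [h1]
    refine (le_abs_self _).trans ((φ.le_opNorm _).trans ?_)
    refine mul_le_of_le_one_right (norm_nonneg _) (hnorm _ _ zero_le_one fun j => ?_)
    rw [hsum]
    split_ifs
    · rcases lt_trichotomy (φ (e j)) 0 with h | h | h <;> simp [h]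
    · simp
  -- Since `x` vanishes at infinity, its finite truncations converge to it in sup norm.
  · have hx : HasSum (fun i => x i • e i) x := by
      rw [HasSum, SummationFilter.unconditional_filter, Metric.tendsto_atTop]
      intro ε hε
      have hz : Tendsto x cofinite (𝓝 0) := by
        rw [← cocompact_eq_cofinite]; exact x.zero_at_infty'
      have hfin : {i | ¬ |x i| < ε / 2}.Finite := by
        have := (tendsto_order.1 hz.abs).2 (ε / 2) (by simpa using half_pos hε)
        exact this
      refine ⟨hfin.toFinset, fun s hs => ?_⟩
      rw [dist_eq_norm]
      refine (hnorm _ (ε / 2) (half_pos hε).le fun j => ?_).trans_lt (half_lt_self hε)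
      rw [ZeroAtInftyContinuousMap.sub_apply, hsum]
      split_ifs with hj
      · simpa using (half_pos hε).le
      · by_contra! hcon
        refine hj (hs ?_)
        simp only [zero_sub, abs_neg] at hcon
        simp [hcon.le]
    have := φ.hasSum hx
    simpa [mul_comm] using this

section KreinSmulian

variable {E F : Type*} [NormedAddCommGroup E] [NormedSpace ℝ E]
  [NormedAddCommGroup F] [NormedSpace ℝ F] (B : E →L[ℝ] F →L[ℝ] ℝ)

/-- The inductive step of the Krein–Šmulian theorem. -/
theorem exists_finset_enlarging_polar
    (hB : ∀ (x : F) (r : ℝ), 0 ≤ r → (∀ z, ‖z‖ ≤ 1 → B z x ≤ r) → ‖x‖ ≤ r)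
    {C : Set F} {R R' : ℝ} (hR : 0 < R)
    (hcomp : ∀ 𝒰 : Ultrafilter F, C ∩ Metric.closedBall 0 R' ∈ 𝒰 →
      ∃ x ∈ C, ∀ z, Tendsto (fun y => B z y) 𝒰 (𝓝 (B z x)))
    {S : Set E} (hS : ∀ x ∈ C, ‖x‖ ≤ R → ∃ z ∈ S, 1 < B z x) :
    ∃ T : Finset E, (∀ z ∈ T, ‖z‖ ≤ R⁻¹) ∧
      ∀ x ∈ C, ‖x‖ ≤ R' → ∃ z ∈ S ∪ T, 1 < B z x := by
  classical
  by_contra! hcon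
  -- A counterexample for each finite part `T` of the ball of radius `R⁻¹` gives a net in a compact
  -- set; its limit lies in the polar of `S` and of the whole ball.
  have hcon' : ∀ T : Finset {z : E // ‖z‖ ≤ R⁻¹}, ∃ x ∈ C, ‖x‖ ≤ R' ∧
      (∀ z ∈ S, B z x ≤ 1) ∧ ∀ z ∈ T, B z x ≤ 1 := by
    intro T
    obtain ⟨x, hxC, hx, hz⟩ := hcon (T.image Subtype.val) (by
      simp only [Finset.mem_image]
      rintro z ⟨w, -, rfl⟩
      exact w.2)
    refine ⟨x, hxC, hx, fun z hz' => hz z (Or.inl hz'), fun z hz' => hz z (Or.inr ?_)⟩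
    simpa using ⟨z.2, hz'⟩
  choose x hxC hxR hxS hxT using hcon'
  let 𝒰 : Ultrafilter F := Ultrafilter.of (map x atTop)
  have h𝒰 : (𝒰 : Filter F) ≤ map x atTop := Ultrafilter.of_le _
  obtain ⟨y, hyC, hy⟩ := hcomp 𝒰 <| h𝒰 <| by
    rw [mem_map]
    exact univ_mem' fun T => ⟨hxC T, by simpa using hxR T⟩
  have hyS : ∀ z ∈ S, B z y ≤ 1 := fun z hz =>
    le_of_tendsto (hy z) (h𝒰 (by rw [mem_map]; exact univ_mem' fun T => hxS T z hz))
  have hyT : ∀ z, ‖z‖ ≤ R⁻¹ → B z y ≤ 1 := fun z hz =>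
    le_of_tendsto (hy z) (h𝒰 (by
      rw [mem_map]
      filter_upwards [eventually_ge_atTop {(⟨z, hz⟩ : {z : E // ‖z‖ ≤ R⁻¹})}] with T hT
      exact hxT T ⟨z, hz⟩ (hT (Finset.mem_singleton_self _))))
  -- Lying in the polar of the ball of radius `R⁻¹` means `‖y‖ ≤ R`, where `S` leaves no point of
  -- `C` in its polar.
  obtain ⟨z, hz, hz1⟩ := hS y hyC <| hB y R hR.le fun z hz => by
    have h := hyT (R⁻¹ • z) (by
      rw [norm_smul, Real.norm_of_nonneg (inv_nonneg.2 hR.le)]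
      exact mul_le_of_le_one_right (inv_nonneg.2 hR.le) hz)
    rw [map_smul, _root_.smul_apply, smul_eq_mul, inv_mul_le_iff₀ hR, mul_one] at h
    exact h
  exact (hyS z hz).not_gt hz1

/-- **Krein–Šmulian**: if `F` is the dual of the Banach space `E` through the pairing `B`, then a
convex set whose bounded parts are weak-* compact and which avoids a ball around the origin is
strictly separated from the origin by an element of `E`. -/
theorem exists_separating_of_isCompact_inter_closedBall [CompleteSpace E]
    (hB : ∀ (x : F) (r : ℝ), 0 ≤ r → (∀ z, ‖z‖ ≤ 1 → B z x ≤ r) → ‖x‖ ≤ r)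
    {C : Set F} (hC : Convex ℝ C)
    (hcomp : ∀ (r : ℝ) (𝒰 : Ultrafilter F), C ∩ Metric.closedBall 0 r ∈ 𝒰 →
      ∃ x ∈ C, ∀ z, Tendsto (fun y => B z y) 𝒰 (𝓝 (B z x)))
    {δ : ℝ} (hδ : 0 < δ) (h0 : ∀ x ∈ C, δ < ‖x‖) :
    ∃ (z : E) (s : ℝ), 0 < s ∧ ∀ x ∈ C, s ≤ B z x := by
  classical
  have hR : ∀ n : ℕ, 0 < δ + n := fun n => by positivity
  have step : ∀ (n : ℕ) (S : {S : Set E // ∀ x ∈ C, ‖x‖ ≤ δ + n → ∃ z ∈ S, 1 < B z x}),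
      ∃ T : Finset E, (∀ z ∈ T, ‖z‖ ≤ (δ + n)⁻¹) ∧
        ∀ x ∈ C, ‖x‖ ≤ δ + (n + 1 : ℕ) → ∃ z ∈ S.1 ∪ T, 1 < B z x := fun n S =>
    exists_finset_enlarging_polar B hB (hR n) (hcomp _) S.2
  choose T hT1 hT2 using step
  -- The recursion can start from `∅` because no point of `C` has norm at most `δ`.
  let S : (n : ℕ) → {S : Set E // ∀ x ∈ C, ‖x‖ ≤ δ + n → ∃ z ∈ S, 1 < B z x} := fun n =>
    Nat.rec ⟨∅, fun x hx hxn => absurd hxn (by simpa using h0 x hx)⟩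
      (fun n S => ⟨S.1 ∪ T n S, hT2 n S⟩) n
  have hS0 : (S 0).1 = ∅ := rfl
  have hSs : ∀ n, (S (n + 1)).1 = (S n).1 ∪ T n (S n) := fun n => rfl
  let K : ℕ → Finset E := fun n => T n (S n)
  have hSK : ∀ n, ∀ z ∈ (S n).1, ∃ m, z ∈ K m := by
    intro n
    induction n with
    | zero => simp [hS0]
    | succ n ih =>
      intro z hz
      rw [hSs] at hz
      rcases hz with hz | hz
      · exact ih z hz
      · exact ⟨n, hz⟩
  have hKnorm : ∀ n, ∀ z ∈ K n, ‖z‖ ≤ (δ + n)⁻¹ := fun n => hT1 n (S n)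
  -- Each `K n` is finite with norms at most `(δ + n)⁻¹`, so the whole family tends to 0. Pairing
  -- with it maps `F` into c₀, and the image of `C` misses the open unit ball.
  let ι := Σ n, K n
  have hlim : ∀ x : F, Tendsto (fun i : ι => B (i.2 : E) x) (cocompact ι) (𝓝 0) := by
    intro x
    rw [cocompact_eq_cofinite, Metric.tendsto_nhds]
    intro ε hε
    obtain ⟨N, hN⟩ := exists_nat_gt (‖B.flip x‖ / ε)
    have hfin : (Sigma.fst ⁻¹' (Set.Iio N) : Set ι).Finite := by
      have : (Sigma.fst ⁻¹' (Set.Iio N) : Set ι) =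
          ⋃ n ∈ Set.Iio N, Set.range (fun z : K n => (⟨n, z⟩ : ι)) := by
        ext ⟨n, z⟩
        simp only [Set.mem_iUnion, Set.mem_range, Set.mem_preimage]
        refine ⟨fun h => ⟨n, h, z, rfl⟩, ?_⟩
        rintro ⟨m, hm, w, hw⟩
        cases hw
        exact hm
      rw [this]
      exact (Set.finite_Iio N).biUnion fun n _ => Set.finite_range _
    refine hfin.subset fun i hi => ?_
    by_contra hiN
    refine hi ?_
    have hiN' : N ≤ i.1 := not_lt.1 hiN
    have h1 : ‖B i.2 x‖ ≤ ‖B.flip x‖ * (δ + i.1)⁻¹ :=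
      ((B.flip x).le_opNorm (i.2 : E)).trans
        (mul_le_mul_of_nonneg_left (hKnorm _ _ i.2.2) (norm_nonneg _))
    change dist (B (i.2 : E) x) 0 < ε
    rw [dist_zero_right]
    refine h1.trans_lt ?_
    rw [← div_eq_mul_inv, div_lt_iff₀ (hR _), mul_comm, ← div_lt_iff₀ hε]
    have : (N : ℝ) ≤ i.1 := by exact_mod_cast hiN'
    linarith
  let A : F →ₗ[ℝ] C₀(ι, ℝ) :=
    { toFun := fun x => ⟨⟨fun i => B (i.2 : E) x, continuous_of_discreteTopology⟩, hlim x⟩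
      map_add' := fun x y => by ext i; exact map_add (B (i.2 : E)) x y
      map_smul' := fun c x => by ext i; exact map_smul (B (i.2 : E)) c x }
  have hA : ∀ x i, A x i = B (i.2 : E) x := fun x i => rfl
  obtain ⟨φ, u, hφ1, hφ2⟩ := geometric_hahn_banach_open (convex_ball (0 : C₀(ι, ℝ)) 1)
    Metric.isOpen_ball (hC.linear_image A) (by
      rw [Set.disjoint_left]
      rintro _ hy ⟨x, hx, rfl⟩
      obtain ⟨N, hN⟩ := exists_nat_gt ‖x‖
      obtain ⟨z, hz, hz1⟩ := (S N).2 x hx (by linarith)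
      obtain ⟨m, hm⟩ := hSK N z hz
      have h1 : ‖A x ⟨m, z, hm⟩‖ ≤ ‖A x‖ := by
        rw [← ZeroAtInftyContinuousMap.norm_toBCF_eq_norm]
        exact (A x).toBCF.norm_coe_le_norm ⟨m, z, hm⟩
      rw [hA] at h1
      have h2 : ‖A x‖ < 1 := by simpa using hy
      linarith [le_abs_self (B z x), Real.norm_eq_abs (B z x)])
  obtain ⟨l, hl, hlφ⟩ := exists_summable_of_dual_zeroAtInfty φ
  -- The separating functional on c₀ is an ℓ¹ family; completeness of `E` turns it into a vector of
  -- `E`.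
  have hsum : Summable (fun i : ι => l i • (i.2 : E)) := by
    refine Summable.of_norm_bounded (hl.mul_right δ⁻¹) fun i => ?_
    rw [norm_smul, Real.norm_eq_abs]
    refine mul_le_mul_of_nonneg_left ((hKnorm _ _ i.2.2).trans ?_) (abs_nonneg _)
    exact inv_anti₀ hδ (by simp)
  refine ⟨∑' i : ι, l i • (i.2 : E), u, by simpa using hφ1 0 (by simp), fun x hx => ?_⟩
  have h1 : HasSum (fun i : ι => l i * B (i.2 : E) x) (B (∑' i : ι, l i • (i.2 : E)) x) := by
    have := (B.flip x).hasSum hsum.hasSum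
    simpa using this
  rw [h1.unique (hlφ (A x))]
  exact hφ2 _ (Set.mem_image_of_mem _ hx)

end KreinSmulian

/-! ### The duality between `L¹` and `L^∞` -/

section Duality

variable {Ω : Type*} {mΩ : MeasurableSpace Ω} {P : Measure Ω}

theorem ae_abs_le_norm (X : Linf P) : ∀ᵐ ω ∂P, |X ω| ≤ ‖X‖ := by
  have h := ae_le_eLpNormEssSup (f := (X : Ω → ℝ)) (μ := P)
  filter_upwards [h] with ω hω
  rw [Lp.norm_def, eLpNorm_exponent_top]
  have hne : eLpNormEssSup (X : Ω → ℝ) P ≠ ⊤ := by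
    rw [← eLpNorm_exponent_top]; exact Lp.eLpNorm_ne_top X
  have := ENNReal.toReal_mono hne hω
  simpa using this

theorem norm_le_of_ae_abs_le {X : Linf P} {r : ℝ} (hr : 0 ≤ r) (h : ∀ᵐ ω ∂P, |X ω| ≤ r) :
    ‖X‖ ≤ r := by
  rw [Lp.norm_def, eLpNorm_exponent_top]
  refine ENNReal.toReal_le_of_le_ofReal hr (eLpNormEssSup_le_of_ae_bound ?_)
  simpa using h

theorem ae_abs_le_of_norm_le {X : Linf P} {r : ℝ} (h : ‖X‖ ≤ r) : ∀ᵐ ω ∂P, |X ω| ≤ r := by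
  filter_upwards [ae_abs_le_norm X] with ω hω
  exact hω.trans h

/-- The pairing `(Z, X) ↦ E[Z X]` between `L¹` and `L^∞`. -/
def pairing (P : Measure Ω) : Lp ℝ 1 P →L[ℝ] Linf P →L[ℝ] ℝ :=
  (ContinuousLinearMap.mul ℝ ℝ).lpPairing P 1 ⊤

theorem pairing_apply (Z : Lp ℝ 1 P) (X : Linf P) : pairing P Z X = ∫ ω, Z ω * X ω ∂P :=
  ContinuousLinearMap.lpPairing_eq_integral _ _ _

theorem pairing_indicatorConstLp {s : Set Ω} (hs : MeasurableSet s) (hμ : P s ≠ ⊤) (c : ℝ)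
    (X : Linf P) : pairing P (indicatorConstLp 1 hs hμ c) X = c * ∫ ω in s, X ω ∂P := by
  rw [pairing_apply, ← integral_indicator hs, ← integral_const_mul]
  refine integral_congr_ae ?_
  filter_upwards [indicatorConstLp_coeFn (p := 1) (hs := hs) (hμs := hμ) (c := c)] with ω hω
  rw [hω]
  by_cases h : ω ∈ s <;> simp [h]

variable [IsProbabilityMeasure P]

theorem integrable_linf (X : Linf P) : Integrable X P :=
  memLp_one_iff_integrable.1 ((Lp.memLp X).mono_exponent le_top)

/-- By homogeneity the bound applies to indicators, where it controls the integral of `X` over every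
measurable set. -/
theorem ae_le_of_pairing_le {X : Linf P} {r : ℝ} (h : ∀ Z, ‖Z‖ ≤ 1 → pairing P Z X ≤ r) :
    ∀ᵐ ω ∂P, X ω ≤ r := by
  have h' : ∀ Z, pairing P Z X ≤ r * ‖Z‖ := by
    intro Z
    rcases eq_or_ne Z 0 with rfl | hZ
    · simp
    · have hZ' : 0 < ‖Z‖ := norm_pos_iff.2 hZ
      have := h (‖Z‖⁻¹ • Z) (by rw [norm_smul, norm_inv, norm_norm, inv_mul_cancel₀ hZ'.ne'])
      rw [map_smul, _root_.smul_apply, smul_eq_mul, inv_mul_le_iff₀ hZ'] at this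
      linarith
  refine ae_le_of_forall_setIntegral_le (integrable_linf X) (integrable_const r) fun s hs hμ => ?_
  have := h' (indicatorConstLp 1 hs hμ.ne 1)
  rw [pairing_indicatorConstLp, norm_indicatorConstLp one_ne_zero ENNReal.one_ne_top] at this
  simpa [mul_comm] using this

theorem norm_le_of_pairing_le {X : Linf P} {r : ℝ} (hr : 0 ≤ r)
    (h : ∀ Z, ‖Z‖ ≤ 1 → pairing P Z X ≤ r) : ‖X‖ ≤ r := by
  refine norm_le_of_ae_abs_le hr ?_
  have h2 : ∀ᵐ ω ∂P, (-X) ω ≤ r := ae_le_of_pairing_le fun Z hZ => by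
    have := h (-Z) (by rwa [norm_neg])
    simpa using this
  filter_upwards [ae_le_of_pairing_le h, h2, Lp.coeFn_neg X] with ω h1 h2 h3
  rw [h3, Pi.neg_apply] at h2
  exact abs_le.2 ⟨by linarith, h1⟩

/-- A subset of `L^∞` is closed under uniformly bounded almost sure limits of sequences. -/
def IsBoundedlyClosed (C : Set (Linf P)) : Prop :=
  ∀ (Xs : ℕ → Linf P) (X : Linf P), (∃ M : ℝ, ∀ n, ‖Xs n‖ ≤ M) → (∀ n, Xs n ∈ C) →
    (∀ᵐ ω ∂P, Tendsto (fun n => Xs n ω) atTop (𝓝 (X ω))) → X ∈ C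

/-- The inclusion of `L^∞` in `L²`. -/
def linfToL2 (P : Measure Ω) [IsProbabilityMeasure P] : Linf P →ₗ[ℝ] Lp ℝ 2 P where
  toFun X := ((Lp.memLp X).mono_exponent le_top).toLp X
  map_add' X Y := by
    rw [← MemLp.toLp_add]
    exact MemLp.toLp_congr _ _ (Lp.coeFn_add X Y)
  map_smul' c X := by
    rw [RingHom.id_apply, ← MemLp.toLp_const_smul]
    exact MemLp.toLp_congr _ _ (Lp.coeFn_smul c X)

theorem coeFn_linfToL2 (X : Linf P) : linfToL2 P X =ᵐ[P] X :=
  MemLp.coeFn_toLp ((Lp.memLp X).mono_exponent le_top)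

theorem norm_linfToL2_le (X : Linf P) : ‖linfToL2 P X‖ ≤ ‖X‖ := by
  have := Lp.norm_le_of_ae_bound (f := linfToL2 P X) (norm_nonneg X) (by
    filter_upwards [coeFn_linfToL2 X, ae_abs_le_norm X] with ω h1 h2
    rw [h1]
    exact h2)
  simpa [measureUnivNNReal] using this

/-- An L²-convergent sequence has an a.s. convergent subsequence, and the bound `r` survives in the
limit, so bounded closedness applies. -/
theorem isClosed_linfToL2_image {C : Set (Linf P)} (hC : IsBoundedlyClosed C) (r : ℝ) :
    IsClosed (linfToL2 P '' (C ∩ Metric.closedBall 0 r)) := by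
  refine IsSeqClosed.isClosed fun k f hk hkf => ?_
  choose X hX hXk using hk
  obtain ⟨ns, -, hns⟩ := (tendstoInMeasure_of_tendsto_Lp hkf).exists_seq_tendsto_ae
  have hXr : ∀ n, ‖X n‖ ≤ r := fun n => by simpa using (hX n).2
  have hXf : ∀ᵐ ω ∂P, Tendsto (fun n => X (ns n) ω) atTop (𝓝 (f ω)) := by
    filter_upwards [hns, ae_all_iff.2 fun n => coeFn_linfToL2 (X n)] with ω h1 h2
    refine h1.congr fun n => ?_
    rw [← hXk, h2]
  have hfr : ∀ᵐ ω ∂P, |f ω| ≤ r := by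
    filter_upwards [hXf, ae_all_iff.2 fun n => ae_abs_le_of_norm_le (hXr n)] with ω h1 h2
    exact le_of_tendsto h1.abs (Eventually.of_forall fun n => h2 _)
  let Y : Linf P := (memLp_top_of_bound (Lp.aestronglyMeasurable f) r hfr).toLp f
  have hY : Y =ᵐ[P] f := MemLp.coeFn_toLp _
  refine ⟨Y, ⟨hC (fun n => X (ns n)) Y ⟨r, fun n => hXr _⟩ (fun n => (hX _).1) ?_, ?_⟩, ?_⟩
  · filter_upwards [hXf, hY] with ω h1 h2
    rwa [h2]
  · rw [mem_closedBall_zero_iff]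
    refine norm_le_of_ae_abs_le ((norm_nonneg _).trans (hXr 0)) ?_
    filter_upwards [hfr, hY] with ω h1 h2
    rwa [h2]
  · refine Lp.ext ?_
    filter_upwards [coeFn_linfToL2 Y, hY] with ω h1 h2
    rw [h1, h2]

/-- The bounded parts of a convex subset of `L^∞` that is closed under bounded almost sure limits
are weak-* compact. -/
theorem exists_tendsto_pairing_of_isBoundedlyClosed {C : Set (Linf P)} (hconv : Convex ℝ C)
    (hC : IsBoundedlyClosed C) (r : ℝ) (𝒰 : Ultrafilter (Linf P))
    (h𝒰 : C ∩ Metric.closedBall 0 r ∈ 𝒰) :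
    ∃ X ∈ C, ∀ Z, Tendsto (fun Y => pairing P Z Y) 𝒰 (𝓝 (pairing P Z X)) := by
  -- Bounded sets of L^∞ are bounded in L², so Banach–Alaoglu in L² supplies a weak limit.
  let D : Linf P → WeakDual ℝ (Lp ℝ 2 P) := fun Y =>
    StrongDual.toWeakDual (InnerProductSpace.toDual ℝ (Lp ℝ 2 P) (linfToL2 P Y))
  have hball : ∀ Y ∈ C ∩ Metric.closedBall 0 r,
      D Y ∈ WeakDual.toStrongDual ⁻¹'
        Metric.closedBall (0 : StrongDual ℝ (Lp ℝ 2 P)) r := by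
    intro Y hY
    rw [Set.mem_preimage, mem_closedBall_zero_iff]
    change ‖InnerProductSpace.toDual ℝ (Lp ℝ 2 P) (linfToL2 P Y)‖ ≤ r
    rw [LinearIsometryEquiv.norm_map]
    exact (norm_linfToL2_le Y).trans (by simpa using hY.2)
  obtain ⟨ℓ, -, hℓ⟩ := isCompact_iff_ultrafilter_le_nhds.1
    (WeakDual.isCompact_closedBall (0 : StrongDual ℝ (Lp ℝ 2 P)) r) (𝒰.map D) (by
      rw [le_principal_iff]
      exact mem_map.2 (mem_of_superset h𝒰 hball))
  let g : Lp ℝ 2 P := (InnerProductSpace.toDual ℝ (Lp ℝ 2 P)).symm (WeakDual.toStrongDual ℓ)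
  have hg : ∀ w, inner ℝ g w = ℓ w := fun w =>
    InnerProductSpace.toDual_symm_apply (y := WeakDual.toStrongDual ℓ)
  have hlim : ∀ w, Tendsto (fun Y => inner ℝ (linfToL2 P Y) w) 𝒰 (𝓝 (inner ℝ g w)) := by
    intro w
    rw [hg]
    exact ((WeakDual.eval_continuous w).tendsto ℓ).comp (f := D) hℓ
  -- The image is convex and norm closed in L², hence weakly closed by Hahn–Banach.
  have hgmem : g ∈ linfToL2 P '' (C ∩ Metric.closedBall 0 r) := by
    by_contra hcon
    obtain ⟨φ, u, hφ1, hφ2⟩ := geometric_hahn_banach_closed_point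
      ((hconv.inter (convex_closedBall 0 r)).linear_image (linfToL2 P))
      (isClosed_linfToL2_image hC r) hcon
    have hφ : ∀ x, φ x = inner ℝ x ((InnerProductSpace.toDual ℝ (Lp ℝ 2 P)).symm φ) := fun x => by
      rw [real_inner_comm]
      exact InnerProductSpace.toDual_symm_apply.symm
    refine hφ2.not_ge ?_
    rw [hφ]
    refine le_of_tendsto (hlim _) ?_
    filter_upwards [h𝒰] with Y hY
    rw [← hφ]
    exact (hφ1 _ ⟨Y, hY, rfl⟩).le
  obtain ⟨X, hX, hXg⟩ := hgmem
  refine ⟨X, hX.1, fun Z => ?_⟩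
  refine Lp.induction ENNReal.one_ne_top
    (motive := fun Z => Tendsto (fun Y => pairing P Z Y) 𝒰 (𝓝 (pairing P Z X))) ?_ ?_ ?_ Z
  · intro c s hs hμs
    rw [Lp.simpleFunc.coe_indicatorConst]
    have key : ∀ Y : Linf P, pairing P (indicatorConstLp 1 hs hμs.ne c) Y =
        inner ℝ (linfToL2 P Y) (indicatorConstLp 2 hs hμs.ne c) := by
      intro Y
      rw [pairing_indicatorConstLp, real_inner_comm, L2.inner_indicatorConstLp_eq_setIntegral_inner,
        ← integral_const_mul]
      refine integral_congr_ae (ae_restrict_of_ae ?_)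
      filter_upwards [coeFn_linfToL2 Y] with ω hω
      rw [hω]
      simp [mul_comm]
    simp only [key]
    rw [hXg]
    exact hlim _
  · intro f g hf hg _ h1 h2
    simpa using h1.add h2
  · rw [← isSeqClosed_iff_isClosed]
    intro Zs Z' hZs hZ'
    -- On the ball of radius `r` the pairings are equi-Lipschitz in the L¹ variable, so convergence
    -- passes to L¹ limits.
    have hr : ∀ᶠ Y in (𝒰 : Filter (Linf P)), ‖Y‖ ≤ r := by
      filter_upwards [h𝒰] with Y hY
      simpa using hY.2
    have hXr : ‖X‖ ≤ r := by simpa using hX.2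
    have hr0 : 0 ≤ r := (norm_nonneg _).trans hXr
    rw [Set.mem_ofPred_eq, Metric.tendsto_nhds]
    intro ε hε
    obtain ⟨n, hn⟩ := ((tendsto_iff_norm_sub_tendsto_zero.1 hZ').eventually
      (gt_mem_nhds (show 0 < ε / (3 * (r + 1)) by positivity))).exists
    rw [lt_div_iff₀ (by positivity)] at hn
    have hbound : ∀ Y : Linf P, ‖Y‖ ≤ r → |pairing P (Zs n) Y - pairing P Z' Y| < ε / 3 := by
      intro Y hY
      have h1 : |pairing P (Zs n) Y - pairing P Z' Y| ≤ ‖Zs n - Z'‖ * ‖Y‖ := by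
        rw [← _root_.sub_apply, ← map_sub, pairing_apply]
        have hi : ∀ᵐ ω ∂P, ‖(Zs n - Z') ω * Y ω‖ ≤ ‖(Zs n - Z') ω‖ * ‖Y‖ := by
          filter_upwards [ae_abs_le_norm Y] with ω hω
          rw [norm_mul]
          exact mul_le_mul_of_nonneg_left hω (abs_nonneg _)
        refine (norm_integral_le_of_norm_le (μ := P) ((L1.integrable_coeFn (Zs n - Z')).norm.mul_const ‖Y‖)
          hi).trans_eq ?_
        rw [integral_mul_const, L1.norm_eq_integral_norm]
      have h2 := mul_le_mul_of_nonneg_left hY (norm_nonneg (Zs n - Z'))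
      have h3 := norm_nonneg (Zs n - Z')
      nlinarith
    have hZn := Metric.tendsto_nhds.1 (hZs n) (ε / 3) (by positivity)
    filter_upwards [hZn, hr] with Y h1 h2
    rw [Real.dist_eq] at h1 ⊢
    have h3 := hbound Y h2
    have h4 := hbound X hXr
    rw [abs_lt] at *
    constructor <;> linarith [h1.1, h1.2, h3.1, h3.2, h4.1, h4.2]

/-- A convex subset of `L^∞` that is closed under bounded almost sure limits is strictly separated
from every point outside of it by an element of `L¹`. -/
theorem exists_pairing_separating {C : Set (Linf P)} (hconv : Convex ℝ C)
    (hC : IsBoundedlyClosed C) {X₀ : Linf P} (hX₀ : X₀ ∉ C) :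
    ∃ (Z : Lp ℝ 1 P) (u : ℝ), (∀ X ∈ C, pairing P Z X ≤ u) ∧ u < pairing P Z X₀ := by
  let C' : Set (Linf P) := (fun Y => Y + X₀) ⁻¹' C
  have hconv' : Convex ℝ C' := hconv.translate_preimage_right X₀ |> fun h => by
    simpa [C', add_comm] using h
  have hC' : IsBoundedlyClosed C' := by
    rintro Xs X ⟨M, hM⟩ hXs hlim
    refine hC (fun n => Xs n + X₀) (X + X₀) ⟨M + ‖X₀‖, fun n => ?_⟩ hXs ?_
    · exact (norm_add_le _ _).trans (by linarith [hM n])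
    · filter_upwards [hlim, Lp.coeFn_add X X₀, ae_all_iff.2 fun n => Lp.coeFn_add (Xs n) X₀]
        with ω h1 h2 h3
      simp only [h2, h3, Pi.add_apply]
      exact h1.add_const _
  -- Norm convergence is a bounded a.s. convergence, so `C'` is norm closed and stays away from the
  -- origin.
  obtain ⟨δ, hδ, h0⟩ : ∃ δ : ℝ, 0 < δ ∧ ∀ Y ∈ C', δ < ‖Y‖ := by
    by_contra! hcon
    choose Y hY hYn using fun n : ℕ => hcon (1 / ((n : ℝ) + 1)) (by positivity)
    refine hX₀ ?_
    have : (0 : Linf P) ∈ C' := by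
      refine hC' Y 0 ⟨1, fun n => (hYn n).trans ?_⟩ hY ?_
      · rw [div_le_one (by positivity)]
        simp
      · filter_upwards [Lp.coeFn_zero ℝ ⊤ P, ae_all_iff.2 fun n => ae_abs_le_of_norm_le (hYn n)]
          with ω h1 h2
        rw [h1]
        exact squeeze_zero_norm h2 tendsto_one_div_add_atTop_nhds_zero_nat
    simpa [C'] using this
  obtain ⟨Z, s, hs, hZ⟩ := exists_separating_of_isCompact_inter_closedBall (pairing P)
    (fun X r hr h => norm_le_of_pairing_le hr h) hconv'
    (exists_tendsto_pairing_of_isBoundedlyClosed hconv' hC') hδ h0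
  refine ⟨-Z, pairing P (-Z) X₀ - s, fun X hX => ?_, by linarith⟩
  have := hZ (X - X₀) (by simpa [C'] using hX)
  rw [map_sub] at this
  simp only [map_neg, _root_.neg_apply]
  linarith

end Duality

/-! ### Affine minorants of Fatou convex risk measures -/

section Minorants

variable {Ω : Type*} {mΩ : MeasurableSpace Ω} {P : Measure Ω}

theorem tendsto_pairing (Z : Lp ℝ 1 P) {Xs : ℕ → Linf P} {X : Linf P}
    (hM : ∃ M : ℝ, ∀ n, ‖Xs n‖ ≤ M)
    (hlim : ∀ᵐ ω ∂P, Tendsto (fun n => Xs n ω) atTop (𝓝 (X ω))) :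
    Tendsto (fun n => pairing P Z (Xs n)) atTop (𝓝 (pairing P Z X)) := by
  obtain ⟨M, hM⟩ := hM
  simp only [pairing_apply]
  refine tendsto_integral_of_dominated_convergence (fun ω => ‖Z ω‖ * M)
    (fun n => (Lp.aestronglyMeasurable Z).mul (Lp.aestronglyMeasurable (Xs n)))
    ((L1.integrable_coeFn Z).norm.mul_const M) (fun n => ?_) ?_
  · filter_upwards [ae_abs_le_of_norm_le (hM n)] with ω hω
    rw [norm_mul]
    exact mul_le_mul_of_nonneg_left hω (norm_nonneg _)
  · filter_upwards [hlim] with ω hω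
    exact hω.const_mul _

variable [IsProbabilityMeasure P]

theorem const_eq_smul (c : ℝ) :
    (Lp.const ⊤ P c : Linf P) = c • (Lp.const ⊤ P (1 : ℝ) : Linf P) := by
  have := (Lp.constₗ ⊤ P ℝ (E := ℝ)).map_smul c 1
  simpa using this

theorem const_one_nonneg : (0 : Linf P) ≤ Lp.const ⊤ P (1 : ℝ) := by
  rw [← Lp.coeFn_nonneg]
  filter_upwards [Lp.coeFn_const (p := ⊤) (μ := P) (1 : ℝ)] with ω hω
  rw [hω]
  simp

theorem le_norm_smul_const_one (X : Linf P) : X ≤ ‖X‖ • (Lp.const ⊤ P (1 : ℝ) : Linf P) := by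
  rw [← const_eq_smul, ← Lp.coeFn_le]
  filter_upwards [Lp.coeFn_const (p := ⊤) (μ := P) ‖X‖, ae_abs_le_norm X] with ω h1 h2
  rw [h1]
  exact (le_abs_self _).trans h2

theorem pairing_eq_zero_of_const_one_eq_zero {Z : Lp ℝ 1 P}
    (hpos : ∀ W, 0 ≤ W → 0 ≤ pairing P Z W) (h : pairing P Z (Lp.const ⊤ P 1) = 0)
    (X : Linf P) : pairing P Z X = 0 := by
  have key : ∀ Y : Linf P, pairing P Z Y ≤ 0 := by
    intro Y
    have := hpos _ (sub_nonneg.2 (le_norm_smul_const_one Y))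
    rw [map_sub, map_smul, h, smul_zero] at this
    linarith
  have h1 := key X
  have h2 := key (-X)
  rw [map_neg] at h2
  linarith

theorem nonneg_of_forall_nat_mul_le {b K : ℝ} (h : ∀ n : ℕ, -(n * b) ≤ K) : 0 ≤ b := by
  by_contra! hb
  obtain ⟨n, hn⟩ := exists_nat_gt (K / -b)
  rw [div_lt_iff₀ (by linarith)] at hn
  linarith [h n]

variable {ρ : Linf P → ℝ}

theorem IsConvexRiskMeasure.map_const (hρ : IsConvexRiskMeasure ρ) (c : ℝ) :
    ρ (Lp.const ⊤ P c) = ρ 0 + c := by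
  simpa using hρ.cash_invariant 0 c

/-- Subtracting any multiple of `W ≥ 0` from an acceptable position keeps it acceptable, so a
negative value at `W` would make `Z` unbounded above on {ρ ≤ 0}. -/
theorem IsConvexRiskMeasure.pairing_nonneg_of_bddAbove (hρ : IsConvexRiskMeasure ρ)
    {Z : Lp ℝ 1 P} {u : ℝ} (h : ∀ X, ρ X ≤ 0 → pairing P Z X ≤ u) {W : Linf P} (hW : 0 ≤ W) :
    0 ≤ pairing P Z W := by
  set X₁ : Linf P := Lp.const ⊤ P (-ρ 0)
  refine nonneg_of_forall_nat_mul_le (K := u - pairing P Z X₁) fun n => ?_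
  have hle : X₁ - (n : ℝ) • W ≤ X₁ := sub_le_self _ (by
    rw [Nat.cast_smul_eq_nsmul]
    exact nsmul_nonneg hW n)
  have h1 : ρ (X₁ - (n : ℝ) • W) ≤ 0 := by
    refine (hρ.monotone _ _ hle).trans ?_
    rw [hρ.map_const]
    simp
  have := h _ h1
  rw [map_sub, map_smul, smul_eq_mul] at this
  linarith

/-- A Fatou convex risk measure is the supremum of its weak-* continuous affine minorants. -/
theorem IsConvexRiskMeasure.exists_affine_minorant (hρ : IsConvexRiskMeasure ρ)
    (hF : Fatou (fun X => ((ρ X : ℝ) : EReal))) (X₀ : Linf P) {t : ℝ} (ht : t < ρ X₀) :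
    ∃ (Z : Lp ℝ 1 P) (a : ℝ), (∀ X, pairing P Z X - a ≤ ρ X) ∧ t < pairing P Z X₀ - a := by
  have hconv : Convex ℝ {X : Linf P | ρ X ≤ 0} := by
    intro X hX Y hY a b ha hb hab
    obtain rfl : b = 1 - a := by linarith
    refine (hρ.convex X Y a ha (by linarith)).trans ?_
    have h1 : ρ X ≤ 0 := hX
    have h2 : ρ Y ≤ 0 := hY
    nlinarith
  have hcl : IsBoundedlyClosed {X : Linf P | ρ X ≤ 0} := by
    intro Xs X hM hXs hlim
    have h1 := hF Xs X hM hlim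
    have h2 : liminf (fun n => ((ρ (Xs n) : ℝ) : EReal)) atTop ≤ 0 := by
      refine (liminf_le_limsup).trans (limsup_le_of_le (by isBoundedDefault) ?_)
      refine Eventually.of_forall fun n => ?_
      have : ρ (Xs n) ≤ 0 := hXs n
      exact_mod_cast this
    have h3 : ((ρ X : ℝ) : EReal) ≤ 0 := h1.trans h2
    exact_mod_cast h3
  have hX₁ : X₀ + Lp.const ⊤ P (-t) ∉ {X : Linf P | ρ X ≤ 0} := by
    change ¬ ρ (X₀ + Lp.const ⊤ P (-t)) ≤ 0
    rw [hρ.cash_invariant]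
    linarith
  obtain ⟨Z, u, hZ, hu⟩ := exists_pairing_separating hconv hcl hX₁
  have hpos : ∀ W, 0 ≤ W → 0 ≤ pairing P Z W := fun W hW =>
    hρ.pairing_nonneg_of_bddAbove hZ hW
  set m := pairing P Z (Lp.const ⊤ P 1) with hm
  have hconst : ∀ c : ℝ, pairing P Z (Lp.const ⊤ P c) = c * m := fun c => by
    rw [const_eq_smul, map_smul, smul_eq_mul]
  -- By cash invariance `X - ρ X` is always acceptable.
  have hX : ∀ X, pairing P Z X - ρ X * m ≤ u := by
    intro X
    have := hZ (X + Lp.const ⊤ P (-ρ X)) (by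
      change ρ (X + Lp.const ⊤ P (-ρ X)) ≤ 0
      rw [hρ.cash_invariant]
      linarith)
    rw [map_add, hconst] at this
    linarith
  rw [map_add, hconst] at hu
  -- If `m` were 0, positivity would make `Z` vanish on L^∞, and no separation would remain.
  have hm0 : 0 < m := by
    refine lt_of_le_of_ne (hpos _ const_one_nonneg) fun h0 => ?_
    have hzero := pairing_eq_zero_of_const_one_eq_zero hpos h0.symm
    have h1 := hX 0
    rw [hzero X₀] at hu
    rw [map_zero] at h1
    rw [← h0] at h1 hu
    linarith
  refine ⟨m⁻¹ • Z, u / m, fun X => ?_, ?_⟩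
  · rw [map_smul, _root_.smul_apply, smul_eq_mul, inv_mul_eq_div, ← sub_div, div_le_iff₀ hm0]
    linarith [hX X]
  · rw [map_smul, _root_.smul_apply, smul_eq_mul, inv_mul_eq_div, ← sub_div, lt_div_iff₀ hm0]
    linarith

/-- On constants ρ has slope 1; a minorant with another slope would overtake it at one of the two
infinities. -/
theorem IsConvexRiskMeasure.pairing_const_one (hρ : IsConvexRiskMeasure ρ) {Z : Lp ℝ 1 P}
    {a : ℝ} (h : ∀ X, pairing P Z X - a ≤ ρ X) : pairing P Z (Lp.const ⊤ P 1) = 1 := by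
  have key : ∀ c : ℝ, c * (pairing P Z (Lp.const ⊤ P 1) - 1) ≤ ρ 0 + a := fun c => by
    have := h (Lp.const ⊤ P c)
    rw [hρ.map_const, const_eq_smul, map_smul, smul_eq_mul] at this
    linarith
  have h1 : 0 ≤ pairing P Z (Lp.const ⊤ P 1) - 1 :=
    nonneg_of_forall_nat_mul_le (K := ρ 0 + a) fun n => by linarith [key (-n)]
  have h2 : 0 ≤ -(pairing P Z (Lp.const ⊤ P 1) - 1) :=
    nonneg_of_forall_nat_mul_le (K := ρ 0 + a) fun n => by linarith [key n]
  linarith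

theorem IsConvexRiskMeasure.pairing_nonneg (hρ : IsConvexRiskMeasure ρ) {Z : Lp ℝ 1 P}
    {a : ℝ} (h : ∀ X, pairing P Z X - a ≤ ρ X) {W : Linf P} (hW : 0 ≤ W) :
    0 ≤ pairing P Z W :=
  hρ.pairing_nonneg_of_bddAbove (u := a) (fun X hX => by linarith [h X]) hW

end Minorants

/-! ### Measures and their densities -/

section Densities

variable {Ω : Type*} {G mΩ : MeasurableSpace Ω} {P : Measure Ω} {hG : G ≤ mΩ}

theorem stronglyMeasurable_density (μ : ACMeasures P hG) : StronglyMeasurable[G] (density μ) :=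
  (SignedMeasure.measurable_rnDeriv _ _).stronglyMeasurable

theorem integrable_density (μ : ACMeasures P hG) : Integrable (density μ) P :=
  integrable_of_integrable_trim hG (SignedMeasure.integrable_rnDeriv _ _)

theorem ACProb.combination_mem {μ ν : ACMeasures P hG} (hμ : μ ∈ ACProb P hG)
    (hν : ν ∈ ACProb P hG) {l : ℝ} (hl0 : 0 ≤ l) (hl1 : l ≤ 1) :
    l • μ + (1 - l) • ν ∈ ACProb P hG := by
  have happ : ∀ A : Set Ω, ((l • μ + (1 - l) • ν : ACMeasures P hG) : @SignedMeasure Ω G) A =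
      l * (μ : @SignedMeasure Ω G) A + (1 - l) * (ν : @SignedMeasure Ω G) A := fun A => rfl
  refine ⟨fun A hA => ?_, ?_⟩
  · rw [happ]
    exact add_nonneg (mul_nonneg hl0 (hμ.1 A hA)) (mul_nonneg (by linarith) (hν.1 A hA))
  · rw [happ, hμ.2, hν.2]
    ring

/-- The density of `μ` as an element of `L¹`. -/
def densityL1 (μ : ACMeasures P hG) : Lp ℝ 1 P := (integrable_density μ).toL1 _

theorem coeFn_densityL1 (μ : ACMeasures P hG) : densityL1 μ =ᵐ[P] density μ :=
  Integrable.coeFn_toL1 _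

theorem expect_eq_pairing (μ : ACMeasures P hG) (X : Linf P) :
    expect μ X = pairing P (densityL1 μ) X := by
  rw [pairing_apply, expect]
  refine integral_congr_ae ?_
  filter_upwards [coeFn_densityL1 μ] with ω hω
  rw [hω]

variable [IsProbabilityMeasure P]

theorem setIntegral_density (μ : ACMeasures P hG) {A : Set Ω} (hA : MeasurableSet[G] A) :
    ∫ ω in A, density μ ω ∂P = (μ : @SignedMeasure Ω G) A := by
  have h1 := SignedMeasure.withDensityᵥ_rnDeriv_eq (μ : @SignedMeasure Ω G) (P.trim hG) μ.2
  rw [setIntegral_trim hG (stronglyMeasurable_density μ) hA]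
  exact (withDensityᵥ_apply (SignedMeasure.integrable_rnDeriv _ _) hA).symm.trans
    (congrArg (fun ν : @SignedMeasure Ω G => ν A) h1)

/-- The measure in `ℳ(𝒢)` with density `f`. -/
def ofDensity (P : Measure Ω) (hG : G ≤ mΩ) (f : Ω → ℝ) : ACMeasures P hG :=
  ⟨(P.trim hG).withDensityᵥ f, Measure.withDensityᵥ_absolutelyContinuous _ _⟩

theorem density_ofDensity {f : Ω → ℝ} (hf : Integrable f P) (hfm : StronglyMeasurable[G] f) :
    density (ofDensity P hG f) =ᵐ[P] f := by
  refine ae_eq_of_ae_eq_trim (hm := hG) ?_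
  refine Integrable.ae_eq_of_withDensityᵥ_eq (SignedMeasure.integrable_rnDeriv _ _)
    (hf.trim hG hfm) ?_
  exact SignedMeasure.withDensityᵥ_rnDeriv_eq _ _ (ofDensity P hG f).2

theorem density_combination (a b : ℝ) (μ ν : ACMeasures P hG) :
    density (a • μ + b • ν) =ᵐ[P] fun ω => a * density μ ω + b * density ν ω := by
  have h1 := SignedMeasure.rnDeriv_add (a • (μ : @SignedMeasure Ω G))
    (b • (ν : @SignedMeasure Ω G)) (P.trim hG)
  have h2 := SignedMeasure.rnDeriv_smul (μ : @SignedMeasure Ω G) (P.trim hG) a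
  have h3 := SignedMeasure.rnDeriv_smul (ν : @SignedMeasure Ω G) (P.trim hG) b
  refine ae_eq_of_ae_eq_trim (hm := hG) ?_
  filter_upwards [h1, h2, h3] with ω h1 h2 h3
  rw [Pi.add_apply, h2, h3] at h1
  exact h1

theorem expect_combination (a b : ℝ) (μ ν : ACMeasures P hG) (X : Linf P) :
    expect (a • μ + b • ν) X = a * expect μ X + b * expect ν X := by
  have : densityL1 (a • μ + b • ν) = a • densityL1 μ + b • densityL1 ν := by
    refine Lp.ext ?_
    filter_upwards [coeFn_densityL1 (a • μ + b • ν), coeFn_densityL1 μ, coeFn_densityL1 ν,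
      density_combination a b μ ν, Lp.coeFn_add (a • densityL1 μ) (b • densityL1 ν),
      Lp.coeFn_smul a (densityL1 μ), Lp.coeFn_smul b (densityL1 ν)] with ω h1 h2 h3 h4 h5 h6 h7
    rw [h1, h4, h5, Pi.add_apply, h6, h7, Pi.smul_apply, Pi.smul_apply, h2, h3, smul_eq_mul,
      smul_eq_mul]
  simp only [expect_eq_pairing, this, map_add, map_smul, _root_.add_apply, _root_.smul_apply,
    smul_eq_mul]

theorem expect_const {μ : ACMeasures P hG} (hμ : μ ∈ ACProb P hG) (c : ℝ) :
    expect μ (Lp.const ⊤ P c) = c := by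
  have h1 := setIntegral_density μ (@MeasurableSet.univ Ω G)
  rw [hμ.2, setIntegral_univ] at h1
  calc expect μ (Lp.const ⊤ P c) = ∫ ω, density μ ω * c ∂P := by
        refine integral_congr_ae ?_
        filter_upwards [Lp.coeFn_const (p := ⊤) (μ := P) c] with ω hω
        rw [hω, Function.const_apply]
    _ = c := by rw [integral_mul_const, h1, one_mul]

theorem const_mem_linfSub (c : ℝ) : (Lp.const ⊤ P c : Linf P) ∈ LinfSub G P := by
  rw [mem_lpMeas_iff_aestronglyMeasurable]
  exact (aestronglyMeasurable_const (b := c)).congr (Lp.coeFn_const (p := ⊤) (μ := P) c).symm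

/-- The restriction to `𝒢` of the measure with density `Z`. -/
def restrictDensity (hG : G ≤ mΩ) (Z : Lp ℝ 1 P) : ACMeasures P hG := ofDensity P hG (P[Z | G])

theorem density_restrictDensity (Z : Lp ℝ 1 P) :
    density (restrictDensity hG Z) =ᵐ[P] P[Z | G] :=
  density_ofDensity integrable_condExp stronglyMeasurable_condExp

theorem expect_restrictDensity (Z : Lp ℝ 1 P) {Y : Linf P} (hY : Y ∈ LinfSub G P) :
    expect (restrictDensity hG Z) Y = pairing P Z Y := by
  rw [mem_lpMeas_iff_aestronglyMeasurable] at hY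
  have hint : Integrable ((Z : Ω → ℝ) * (Y : Ω → ℝ)) P :=
    (L1.integrable_coeFn Z).mul_of_top_left (Lp.memLp Y)
  have h1 := condExp_mul_of_aestronglyMeasurable_right hY hint (L1.integrable_coeFn Z)
  rw [pairing_apply, expect]
  calc ∫ ω, density (restrictDensity hG Z) ω * Y ω ∂P
      = ∫ ω, (P[(Z : Ω → ℝ) * (Y : Ω → ℝ) | G]) ω ∂P := by
        refine integral_congr_ae ?_
        filter_upwards [h1, density_restrictDensity (hG := hG) Z] with ω h1 h2
        rw [h1, h2, Pi.mul_apply]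
    _ = ∫ ω, Z ω * Y ω ∂P := integral_condExp hG

theorem restrictDensity_mem_ACProb {Z : Lp ℝ 1 P} (hpos : ∀ W, 0 ≤ W → 0 ≤ pairing P Z W)
    (hone : pairing P Z (Lp.const ⊤ P 1) = 1) : restrictDensity hG Z ∈ ACProb P hG := by
  have happ : ∀ A : Set Ω, MeasurableSet[G] A →
      (restrictDensity hG Z : @SignedMeasure Ω G) A = ∫ ω in A, Z ω ∂P := by
    intro A hA
    rw [← setIntegral_density _ hA, ← setIntegral_condExp hG (L1.integrable_coeFn Z) hA]
    exact integral_congr_ae (ae_restrict_of_ae (density_restrictDensity Z))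
  refine ⟨fun A hA => ?_, ?_⟩
  · have hA' := hG A hA
    have hcoe := indicatorConstLp_coeFn (p := ⊤) (hs := hA') (hμs := measure_ne_top P A)
      (c := (1 : ℝ))
    have h0 : (0 : Linf P) ≤ indicatorConstLp ⊤ hA' (measure_ne_top P A) (1 : ℝ) := by
      rw [← Lp.coeFn_nonneg]
      filter_upwards [hcoe] with ω hω
      rw [hω]
      exact Set.indicator_nonneg (fun _ _ => zero_le_one) ω
    rw [happ A hA, ← integral_indicator hA']
    refine (hpos _ h0).trans_eq ?_
    rw [pairing_apply]
    refine integral_congr_ae ?_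
    filter_upwards [hcoe] with ω hω
    rw [hω]
    by_cases h : ω ∈ A <;> simp [h]
  · rw [happ _ MeasurableSet.univ, setIntegral_univ, ← hone, pairing_apply]
    refine integral_congr_ae ?_
    filter_upwards [Lp.coeFn_const (p := ⊤) (μ := P) (1 : ℝ)] with ω hω
    rw [hω, Function.const_apply, mul_one]

end Densities

section Representation

variable {Ω : Type*} {G mΩ : MeasurableSpace Ω} {P : Measure Ω} {hG : G ≤ mΩ}

/-! ### From CoA-assignments to risk measures -/

section Sufficiency

variable {τ : ACProb P hG → Linf P → EReal} {ρ : Linf P → ℝ}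

theorem Represents.le (hrep : Represents τ ρ) (μ : ACProb P hG) {t : Linf P → ℝ}
    (ht : ∀ X, τ μ X = ((t X : ℝ) : EReal)) (X : Linf P) :
    expect (μ : ACMeasures P hG) X + t X ≤ ρ X := by
  have h := le_iSup (fun μ : ACProb P hG =>
    ((expect (μ : ACMeasures P hG) X : ℝ) : EReal) + τ μ X) μ
  rw [← hrep X] at h
  simp only [ht] at h
  exact_mod_cast h

theorem Represents.le_of_forall (hrep : Represents τ ρ) (hτ : IsCoAAssignment τ) {X : Linf P}
    {c : ℝ} (h : ∀ (μ : ACProb P hG) (t : Linf P → ℝ),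
      IsRealConvexAdjustment (μ : ACMeasures P hG) t → (∀ X, τ μ X = ((t X : ℝ) : EReal)) →
        expect (μ : ACMeasures P hG) X + t X ≤ c) :
    ρ X ≤ c := by
  have : ((ρ X : ℝ) : EReal) ≤ c := by
    rw [hrep X]
    refine iSup_le fun μ => ?_
    rcases hτ.adjustment μ with ⟨t, ht, hτt⟩ | hbot
    · rw [hτt]
      exact_mod_cast h μ t ht hτt
    · simp [hbot]
  exact_mod_cast this

/-- Each term of the supremum is Fatou: `expect` converges by dominated convergence and `τ μ` is
Fatou by assumption. -/
theorem Represents.fatou (hrep : Represents τ ρ) (hτ : IsCoAAssignment τ) :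
    Fatou (fun X => ((ρ X : ℝ) : EReal)) := by
  intro Xs X hM hlim
  beta_reduce
  rw [hrep X]
  refine iSup_le fun μ => ?_
  have h1 : Tendsto (fun n => ((expect (μ : ACMeasures P hG) (Xs n) : ℝ) : EReal)) atTop
      (𝓝 ((expect (μ : ACMeasures P hG) X : ℝ) : EReal)) := by
    refine (continuous_coe_real_ereal.tendsto _).comp ?_
    simp only [expect_eq_pairing]
    exact tendsto_pairing _ hM hlim
  rw [← h1.liminf_eq]
  refine (add_le_add le_rfl (hτ.fatou μ Xs X hM hlim)).trans (EReal.le_liminf_add.trans ?_)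
  refine liminf_le_liminf (Eventually.of_forall fun n => ?_)
  rw [hrep (Xs n)]
  exact le_iSup (fun μ : ACProb P hG =>
    ((expect (μ : ACMeasures P hG) (Xs n) : ℝ) : EReal) + τ μ (Xs n)) μ

variable [IsProbabilityMeasure P]

theorem Represents.isConvexRiskMeasure (hrep : Represents τ ρ) (hτ : IsCoAAssignment τ) :
    IsConvexRiskMeasure ρ := by
  have hcash : ∀ (X : Linf P) (c : ℝ), ρ (X + Lp.const ⊤ P c) ≤ ρ X + c := fun X c =>
    hrep.le_of_forall hτ fun μ t ht hτt => by
      have h1 := hrep.le μ hτt X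
      rw [ht.invariant X _ (const_mem_linfSub c), expect_eq_pairing, map_add,
        ← expect_eq_pairing, ← expect_eq_pairing, expect_const μ.2]
      linarith
  refine ⟨fun X c => le_antisymm (hcash X c) ?_, fun X Y hXY => ?_, fun X Y l hl0 hl1 => ?_⟩
  -- The reverse inequality is the same one with `c` replaced by `-c`.
  · have h1 := hcash (X + Lp.const ⊤ P c) (-c)
    rw [map_neg, add_neg_cancel_right] at h1
    linarith
  · exact hrep.le_of_forall hτ fun μ t ht hτt =>
      (ht.monotone X Y hXY).trans (hrep.le μ hτt Y)
  · refine hrep.le_of_forall hτ fun μ t ht hτt => ?_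
    have h1 := mul_le_mul_of_nonneg_left (hrep.le μ hτt X) hl0
    have h2 := mul_le_mul_of_nonneg_left (hrep.le μ hτt Y) (sub_nonneg.2 hl1)
    have h3 := ht.convex X Y l hl0 hl1
    rw [expect_eq_pairing, map_add, map_smul, map_smul, ← expect_eq_pairing,
      ← expect_eq_pairing, smul_eq_mul, smul_eq_mul]
    linarith

end Sufficiency

/-! ### From risk measures to CoA-assignments -/

/-- The affine minorants `X ↦ E[Z X] - a` of `ρ` for which `Z` and `μ` agree on `𝒢`. -/
def minorants (ρ : Linf P → ℝ) (μ : ACMeasures P hG) : Set (Lp ℝ 1 P × ℝ) :=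
  {p | (∀ X, pairing P p.1 X - p.2 ≤ ρ X) ∧ ∀ Y ∈ LinfSub G P, pairing P p.1 Y = expect μ Y}

/-- The largest excess over `E^μ[X]` of the affine minorants of `ρ` that agree with `μ` on `𝒢`. -/
def excess (ρ : Linf P → ℝ) (μ : ACMeasures P hG) (X : Linf P) : EReal :=
  ⨆ p : minorants ρ μ, ((pairing P p.1.1 X - p.1.2 - expect μ X : ℝ) : EReal)

/-- The real version of `excess`. -/
def excessReal (ρ : Linf P → ℝ) (μ : ACMeasures P hG) (X : Linf P) : ℝ :=
  ⨆ p : minorants ρ μ, (pairing P p.1.1 X - p.1.2 - expect μ X)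

variable {ρ : Linf P → ℝ} {μ : ACMeasures P hG}

theorem le_excessReal (p : minorants ρ μ) (X : Linf P) :
    pairing P p.1.1 X - p.1.2 - expect μ X ≤ excessReal ρ μ X := by
  refine le_ciSup (f := fun p : minorants ρ μ => pairing P p.1.1 X - p.1.2 - expect μ X) ?_ p
  refine ⟨ρ X - expect μ X, ?_⟩
  rintro _ ⟨q, rfl⟩
  linarith [q.2.1 X]

theorem excess_eq_coe [Nonempty (minorants ρ μ)] (X : Linf P) :
    excess ρ μ X = ((excessReal ρ μ X : ℝ) : EReal) := by
  refine le_antisymm (iSup_le fun p => EReal.coe_le_coe_iff.2 (le_excessReal p X)) ?_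
  refine EReal.ge_of_forall_gt_iff_ge.1 fun c hc => ?_
  obtain ⟨p, hp⟩ := exists_lt_of_lt_ciSup (EReal.coe_lt_coe_iff.1 hc)
  exact (EReal.coe_lt_coe_iff.2 hp).le.trans (le_iSup (fun p : minorants ρ μ =>
    ((pairing P p.1.1 X - p.1.2 - expect μ X : ℝ) : EReal)) p)

theorem excess_eq_bot (h : IsEmpty (minorants ρ μ)) (X : Linf P) : excess ρ μ X = ⊥ :=
  iSup_of_empty _

theorem combination_mem_minorants {ν υ : ACMeasures P hG} {p q : Lp ℝ 1 P × ℝ} {l : ℝ}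
    (hp : p ∈ minorants ρ μ) (hq : q ∈ minorants ρ ν) (hl0 : 0 ≤ l) (hl1 : l ≤ 1)
    (hυ : ∀ X, expect υ X = l * expect μ X + (1 - l) * expect ν X) :
    (l • p + (1 - l) • q) ∈ minorants ρ υ := by
  have hpair : ∀ X, pairing P (l • p + (1 - l) • q).1 X =
      l * pairing P p.1 X + (1 - l) * pairing P q.1 X := fun X => by
    simp only [Prod.fst_add, Prod.smul_fst, map_add, map_smul, _root_.add_apply,
      _root_.smul_apply, smul_eq_mul]
  refine ⟨fun X => ?_, fun Y hY => ?_⟩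
  · have h1 := mul_le_mul_of_nonneg_left (hp.1 X) hl0
    have h2 := mul_le_mul_of_nonneg_left (hq.1 X) (sub_nonneg.2 hl1)
    rw [hpair]
    simp only [Prod.snd_add, Prod.smul_snd, smul_eq_mul]
    linarith
  · rw [hpair, hυ, hp.2 Y hY, hq.2 Y hY]

theorem excess_fatou : Fatou (excess ρ μ) := by
  intro Xs X hM hlim
  refine iSup_le fun p => ?_
  have h1 : Tendsto (fun n => ((pairing P p.1.1 (Xs n) - p.1.2 - expect μ (Xs n) : ℝ) : EReal))
      atTop (𝓝 ((pairing P p.1.1 X - p.1.2 - expect μ X : ℝ) : EReal)) := by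
    refine (continuous_coe_real_ereal.tendsto _).comp ?_
    simp only [expect_eq_pairing]
    exact ((tendsto_pairing _ hM hlim).sub_const _).sub (tendsto_pairing _ hM hlim)
  rw [← h1.liminf_eq]
  refine liminf_le_liminf (Eventually.of_forall fun n => ?_)
  exact le_iSup (fun p : minorants ρ μ =>
    ((pairing P p.1.1 (Xs n) - p.1.2 - expect μ (Xs n) : ℝ) : EReal)) p

variable [IsProbabilityMeasure P]

/-- Invariance holds minorant by minorant because `Z` and `μ` agree on 𝒢; monotonicity comes from
positivity of `Z`. -/
theorem excessReal_isRealConvexAdjustment (hρ : IsConvexRiskMeasure ρ)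
    [Nonempty (minorants ρ μ)] : IsRealConvexAdjustment μ (excessReal ρ μ) := by
  refine ⟨fun X Y hY => ?_, fun X Y hXY => ?_, fun X Y l hl0 hl1 => ?_⟩
  · refine iSup_congr fun p => ?_
    simp only [expect_eq_pairing, map_add]
    rw [p.2.2 Y hY, expect_eq_pairing]
    ring
  · have : excessReal ρ μ X ≤ expect μ Y + excessReal ρ μ Y - expect μ X := by
      refine ciSup_le fun p => ?_
      have h1 := le_excessReal p Y
      have h2 := hρ.pairing_nonneg p.2.1 (sub_nonneg.2 hXY)
      rw [map_sub] at h2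
      linarith
    linarith
  · refine ciSup_le fun p => ?_
    have h1 := mul_le_mul_of_nonneg_left (le_excessReal p X) hl0
    have h2 := mul_le_mul_of_nonneg_left (le_excessReal p Y) (sub_nonneg.2 hl1)
    simp only [expect_eq_pairing, map_add, map_smul, smul_eq_mul] at h1 h2 ⊢
    linarith

theorem excess_isConvexAdjustment (hρ : IsConvexRiskMeasure ρ) :
    IsConvexAdjustment μ (excess ρ μ) := by
  rcases isEmpty_or_nonempty (minorants ρ μ) with h | h
  · exact Or.inr (excess_eq_bot h)
  · exact Or.inl ⟨excessReal ρ μ, excessReal_isRealConvexAdjustment hρ, excess_eq_coe⟩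

theorem excess_concave {ν υ : ACMeasures P hG} {l : ℝ} (hl0 : 0 ≤ l) (hl1 : l ≤ 1)
    (hυ : υ = l • μ + (1 - l) • ν) :
    (l : EReal) * excess ρ μ 0 + ((1 - l : ℝ) : EReal) * excess ρ ν 0 ≤ excess ρ υ 0 := by
  -- The endpoints are separate because there `0 * ⊥ = 0`; for interior weights an empty set of
  -- minorants makes the left side `⊥`.
  rcases hl0.eq_or_lt with rfl | hl0'
  · simp [hυ]
  rcases hl1.eq_or_lt with rfl | hl1'
  · simp [hυ]
  rcases isEmpty_or_nonempty (minorants ρ μ) with h | h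
  · simp [excess_eq_bot h, EReal.coe_mul_bot_of_pos hl0']
  rcases isEmpty_or_nonempty (minorants ρ ν) with h' | h'
  · rw [excess_eq_bot h', EReal.coe_mul_bot_of_pos (sub_pos.2 hl1'), EReal.add_bot]
    exact bot_le
  have hmem : ∀ (p : minorants ρ μ) (q : minorants ρ ν),
      l • p.1 + (1 - l) • q.1 ∈ minorants ρ υ := fun p q =>
    combination_mem_minorants p.2 q.2 hl0 hl1 fun X => by rw [hυ, expect_combination]
  have : Nonempty (minorants ρ υ) := ⟨⟨_, hmem h.some h'.some⟩⟩
  rw [excess_eq_coe, excess_eq_coe, excess_eq_coe, ← EReal.coe_mul, ← EReal.coe_mul,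
    ← EReal.coe_add, EReal.coe_le_coe_iff]
  have hpq : ∀ (p : minorants ρ μ) (q : minorants ρ ν),
      l * (-p.1.2) + (1 - l) * (-q.1.2) ≤ excessReal ρ υ 0 := by
    intro p q
    have := le_excessReal ⟨_, hmem p q⟩ 0
    simp only [expect_eq_pairing, map_zero, Prod.snd_add, Prod.smul_snd, smul_eq_mul] at this
    linarith
  have hval : ∀ {κ : ACMeasures P hG} (p : minorants ρ κ),
      pairing P p.1.1 0 - p.1.2 - expect κ 0 = -p.1.2 := fun p => by
    simp [expect_eq_pairing]
  -- The two suprema are taken one after the other: over `p` with `q` fixed, then over `q`.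
  have h1 : ∀ q : minorants ρ ν,
      excessReal ρ μ 0 ≤ (excessReal ρ υ 0 + (1 - l) * q.1.2) / l := fun q =>
    ciSup_le fun p => by
      rw [hval, le_div_iff₀ hl0']
      linarith [hpq p q]
  have h2 : excessReal ρ ν 0 ≤ (excessReal ρ υ 0 - l * excessReal ρ μ 0) / (1 - l) :=
    ciSup_le fun q => by
      have := h1 q
      rw [le_div_iff₀ hl0'] at this
      rw [hval, le_div_iff₀ (sub_pos.2 hl1')]
      linarith
  rw [le_div_iff₀ (sub_pos.2 hl1')] at h2
  linarith

theorem excess_isCoAAssignment (hρ : IsConvexRiskMeasure ρ) :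
    IsCoAAssignment (fun μ : ACProb P hG => excess ρ (μ : ACMeasures P hG)) where
  adjustment _ := excess_isConvexAdjustment hρ
  fatou _ := excess_fatou
  concave _ _ _ _ hl0 hl1 h := excess_concave hl0 hl1 h

/-- A minorant (Z, a) nearly attaining ρ at `X` is counted at the measure obtained by restricting
Z·P to 𝒢; conversely every counted minorant lies below ρ. -/
theorem excess_represents (hρ : IsConvexRiskMeasure ρ)
    (hF : Fatou (fun X => ((ρ X : ℝ) : EReal))) :
    Represents (fun μ : ACProb P hG => excess ρ (μ : ACMeasures P hG)) ρ := by
  intro X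
  refine le_antisymm ?_ (iSup_le fun μ => ?_)
  · refine EReal.ge_of_forall_gt_iff_ge.1 fun c hc => ?_
    obtain ⟨Z, a, hZ, hc'⟩ := hρ.exists_affine_minorant hF X (EReal.coe_lt_coe_iff.1 hc)
    have hμ : restrictDensity hG Z ∈ ACProb P hG :=
      restrictDensity_mem_ACProb (fun W hW => hρ.pairing_nonneg hZ hW) (hρ.pairing_const_one hZ)
    have hmem : (Z, a) ∈ minorants ρ (restrictDensity hG Z) :=
      ⟨hZ, fun Y hY => (expect_restrictDensity Z hY).symm⟩
    refine le_trans ?_ (le_iSup (fun μ : ACProb P hG =>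
      ((expect (μ : ACMeasures P hG) X : ℝ) : EReal) + excess ρ (μ : ACMeasures P hG) X) ⟨_, hμ⟩)
    have : Nonempty (minorants ρ (restrictDensity hG Z)) := ⟨⟨_, hmem⟩⟩
    have h1 := le_excessReal ⟨_, hmem⟩ X
    rw [excess_eq_coe, ← EReal.coe_add, EReal.coe_le_coe_iff]
    dsimp only at h1 ⊢
    linarith
  · rcases isEmpty_or_nonempty (minorants ρ (μ : ACMeasures P hG)) with h | h
    · simp [excess_eq_bot h]
    · dsimp only
      rw [excess_eq_coe, ← EReal.coe_add, EReal.coe_le_coe_iff, ← le_sub_iff_add_le']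
      refine ciSup_le fun p => ?_
      linarith [p.2.1 X]

end Representation

/-! ### Random variables on atomless spaces -/

section Divisible

variable {Ω : Type*} {mΩ : MeasurableSpace Ω}

/-- Every measurable set has measurable subsets of every smaller measure. -/
def IsDivisible (Q : Measure Ω) : Prop :=
  ∀ B : Set Ω, MeasurableSet B → ∀ p ≤ Q B, ∃ A ⊆ B, MeasurableSet A ∧ Q A = p

variable {Q : Measure Ω}

/-- This reduces equality of joint laws to equality of the laws on the fibres of `N`. -/
theorem map_prodMk_eq_sum {N : Ω → ℤ} (hN : Measurable N) {X : Ω → ℝ} (hX : Measurable X) :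
    Q.map (fun ω => (N ω, X ω)) =
      Measure.sum fun i : ℤ => ((Q.restrict (N ⁻¹' {i})).map X).map (Prod.mk i) := by
  have hsum : Q = Measure.sum fun i : ℤ => Q.restrict (N ⁻¹' {i}) := by
    rw [← Measure.restrict_iUnion (fun i j hij => ?_) fun i => hN (measurableSet_singleton i)]
    · rw [← Set.preimage_iUnion, Set.iUnion_of_singleton, Set.preimage_univ, Measure.restrict_univ]
    · exact Disjoint.preimage _ (by simpa using hij)
  conv_lhs => rw [hsum]
  rw [Measure.map_sum (hN.prodMk hX).aemeasurable]
  congr 1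
  funext i
  rw [Measure.map_map measurable_prodMk_left hX]
  refine Measure.map_congr ?_
  filter_upwards [ae_restrict_mem (hN (measurableSet_singleton i))] with ω hω
  have : N ω = i := hω
  simp [this]

theorem abs_sub_mul_floor_le {δ : ℝ} (hδ : 0 < δ) (a : ℝ) : |a - δ * ⌊a / δ⌋| ≤ δ := by
  have h1 := Int.floor_le (a / δ)
  have h2 := Int.lt_floor_add_one (a / δ)
  rw [le_div_iff₀ hδ] at h1
  rw [div_lt_iff₀ hδ] at h2
  rw [abs_le]
  constructor <;> linarith

theorem integrable_sub_mul_floor_mul {δ : ℝ} (hδ : 0 < δ) {A B : Ω → ℝ} (hA : Measurable A)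
    (hB : Integrable B Q) : Integrable (fun ω => (A ω - δ * ⌊A ω / δ⌋) * B ω) Q := by
  have hm : Measurable fun ω => A ω - δ * ⌊A ω / δ⌋ :=
    hA.sub ((measurable_from_top.comp (hA.div_const δ).floor).const_mul δ)
  exact hB.bdd_mul hm.aestronglyMeasurable
    (Eventually.of_forall fun ω => abs_sub_mul_floor_le hδ (A ω))

theorem abs_integral_sub_mul_floor_mul_le {δ : ℝ} (hδ : 0 < δ) {A B : Ω → ℝ}
    (hB : Integrable B Q) :
    |∫ ω, (A ω - δ * ⌊A ω / δ⌋) * B ω ∂Q| ≤ δ * ∫ ω, |B ω| ∂Q := by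
  rw [← integral_const_mul]
  refine norm_integral_le_of_norm_le (μ := Q)
    (f := fun ω => (A ω - δ * ⌊A ω / δ⌋) * B ω) (hB.abs.const_mul δ) (Eventually.of_forall fun ω => ?_)
  rw [norm_mul]
  exact mul_le_mul_of_nonneg_right (abs_sub_mul_floor_le hδ (A ω)) (abs_nonneg _)

/-! ### Increasing chains of sets and copies of random variables -/

variable [IsFiniteMeasure Q]

theorem IsDivisible.exists_between (hQ : IsDivisible Q) {S S' : Set Ω} (hS : MeasurableSet S)
    (hS' : MeasurableSet S') (hSS' : S ⊆ S') :
    ∃ M, MeasurableSet M ∧ S ⊆ M ∧ M ⊆ S' ∧ Q.real M = (Q.real S + Q.real S') / 2 := by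
  have hle : Q.real S ≤ Q.real S' := measureReal_mono hSS'
  have hdiff : Q.real (S' \ S) = Q.real S' - Q.real S := measureReal_sdiff hSS' hS
  obtain ⟨A, hA, hAm, hAQ⟩ := hQ (S' \ S) (hS'.diff hS)
    (ENNReal.ofReal ((Q.real S' - Q.real S) / 2)) (by
      rw [← ofReal_measureReal (measure_ne_top Q (S' \ S)), hdiff]
      exact ENNReal.ofReal_le_ofReal (by linarith))
  refine ⟨S ∪ A, hS.union hAm, Set.subset_union_left,
    Set.union_subset hSS' (hA.trans Set.sdiff_subset), ?_⟩
  rw [measureReal_union (Set.disjoint_left.2 fun ω h1 h2 => (hA h2).2 h1) hAm,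
    measureReal_def Q A, hAQ, ENNReal.toReal_ofReal (by linarith)]
  ring

/-- An increasing family of sets indexed by the dyadic numbers of `[0, 1]`. -/
theorem IsDivisible.exists_dyadic_chain (hQ : IsDivisible Q) {B : Set Ω} (hB : MeasurableSet B) :
    ∃ T : ℕ → ℕ → Set Ω, (∀ n k, MeasurableSet (T n k)) ∧ (∀ n k, T n k ⊆ B) ∧
      (∀ n, Monotone (T n)) ∧ (∀ n k, T (n + 1) (2 * k) = T n k) ∧
      ∀ n k, k ≤ 2 ^ n → Q.real (T n k) = k / 2 ^ n * Q.real B := by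
  classical
  choose! mid hm1 hm2 hm3 hm4 using fun (S S' : Set Ω) (hS : MeasurableSet S)
    (hS' : MeasurableSet S') (h : S ⊆ S') => hQ.exists_between hS hS' h
  -- Level `n + 1` keeps level `n` at the even indices and inserts a set of intermediate measure at
  -- the odd ones.
  let T : ℕ → ℕ → Set Ω := fun n => Nat.rec (fun k => if k = 0 then ∅ else B)
    (fun _ f k => if k % 2 = 0 then f (k / 2) else mid (f (k / 2)) (f (k / 2 + 1))) n
  have h0 : ∀ k, T 0 k = if k = 0 then ∅ else B := fun k => rfl
  have heven : ∀ n k, T (n + 1) (2 * k) = T n k := fun n k => by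
    change (if 2 * k % 2 = 0 then T n (2 * k / 2) else _) = _
    rw [if_pos (by lia), show 2 * k / 2 = k by lia]
  have hodd : ∀ n k, T (n + 1) (2 * k + 1) = mid (T n k) (T n (k + 1)) := fun n k => by
    change (if (2 * k + 1) % 2 = 0 then T n ((2 * k + 1) / 2) else
      mid (T n ((2 * k + 1) / 2)) (T n ((2 * k + 1) / 2 + 1))) = _
    rw [if_neg (by lia), show (2 * k + 1) / 2 = k by lia]
  have hinv : ∀ n, (∀ k, MeasurableSet (T n k)) ∧ (∀ k, T n k ⊆ B) ∧
      (∀ k, T n k ⊆ T n (k + 1)) ∧ ∀ k, k ≤ 2 ^ n → Q.real (T n k) = k / 2 ^ n * Q.real B := by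
    intro n
    induction n with
    | zero =>
      refine ⟨fun k => ?_, fun k => ?_, fun k => ?_, fun k hk => ?_⟩
      · rw [h0]
        split_ifs <;> simp [hB]
      · rw [h0]
        split_ifs <;> simp
      · rw [h0, h0]
        split_ifs <;> simp_all
      · rw [pow_zero] at hk
        rw [h0]
        interval_cases k <;> simp
    | succ n ih =>
      obtain ⟨i1, i2, i3, i4⟩ := ih
      refine ⟨fun k => ?_, fun k => ?_, fun k => ?_, fun k hk => ?_⟩ <;>
        obtain ⟨j, rfl | rfl⟩ := Nat.even_or_odd' k
      · rw [heven]; exact i1 j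
      · rw [hodd]; exact hm1 _ _ (i1 _) (i1 _) (i3 _)
      · rw [heven]; exact i2 j
      · rw [hodd]; exact (hm3 _ _ (i1 _) (i1 _) (i3 _)).trans (i2 _)
      · rw [heven, hodd]; exact hm2 _ _ (i1 _) (i1 _) (i3 _)
      · rw [hodd, show 2 * j + 1 + 1 = 2 * (j + 1) by ring, heven]
        exact hm3 _ _ (i1 _) (i1 _) (i3 _)
      · rw [pow_succ] at hk
        rw [heven, i4 j (by lia)]
        push_cast
        field_simp
        ring
      · rw [pow_succ] at hk
        rw [hodd, hm4 _ _ (i1 _) (i1 _) (i3 _), i4 j (by lia), i4 (j + 1) (by lia)]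
        push_cast
        field_simp
        ring
  exact ⟨T, fun n => (hinv n).1, fun n => (hinv n).2.1,
    fun n => monotone_nat_of_le_succ (hinv n).2.2.1, heven, fun n => (hinv n).2.2.2⟩

/-- A set of an atomless space is filled by an increasing family of subsets whose measures grow
linearly. -/
theorem IsDivisible.exists_chain (hQ : IsDivisible Q) {B : Set Ω} (hB : MeasurableSet B) :
    ∃ A : ℝ → Set Ω, (∀ t, MeasurableSet (A t)) ∧ (∀ t, A t ⊆ B) ∧ Monotone A ∧
      ∀ t, 0 ≤ t → t ≤ 1 → Q.real (A t) = t * Q.real B := by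
  obtain ⟨T, hT1, hT2, hT3, hT4, hT5⟩ := hQ.exists_dyadic_chain hB
  refine ⟨fun t => ⋃ n : ℕ, T n ⌊t * 2 ^ n⌋₊, fun t => MeasurableSet.iUnion fun n => hT1 _ _,
    fun t => Set.iUnion_subset fun n => hT2 _ _, fun s t hst => ?_, fun t ht0 ht1 => ?_⟩
  · refine Set.iUnion_mono fun n => hT3 n (Nat.floor_mono ?_)
    exact mul_le_mul_of_nonneg_right hst (by positivity)
  -- This rests on `2⌊t 2ⁿ⌋ ≤ ⌊t 2ⁿ⁺¹⌋`.
  · have hmono : Monotone fun n : ℕ => T n ⌊t * 2 ^ n⌋₊ := by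
      refine monotone_nat_of_le_succ fun n => ?_
      rw [← hT4]
      refine hT3 _ (Nat.le_floor ?_)
      have := Nat.floor_le (show 0 ≤ t * 2 ^ n by positivity)
      push_cast
      rw [pow_succ]
      linarith
    have h1 : Tendsto (fun n : ℕ => Q.real (T n ⌊t * 2 ^ n⌋₊)) atTop
        (𝓝 (Q.real (⋃ n : ℕ, T n ⌊t * 2 ^ n⌋₊))) :=
      (ENNReal.tendsto_toReal (measure_ne_top _ _)).comp (tendsto_measure_iUnion_atTop hmono)
    refine tendsto_nhds_unique h1 ?_
    have h2 : ∀ n : ℕ, Q.real (T n ⌊t * 2 ^ n⌋₊) = (⌊t * 2 ^ n⌋₊ : ℝ) / 2 ^ n * Q.real B := by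
      intro n
      refine hT5 _ _ (Nat.floor_le_of_le ?_)
      push_cast
      exact mul_le_of_le_one_left (by positivity) ht1
    simp only [h2]
    exact ((tendsto_nat_floor_mul_div_atTop ht0).comp
      (tendsto_pow_atTop_atTop_of_one_lt one_lt_two)).mul_const _

/-- In an atomless space, the law of a random variable on an event can be reproduced on any other
event of the same measure. -/
theorem IsDivisible.exists_map_restrict_eq (hQ : IsDivisible Q) {B B' : Set Ω}
    (hB' : MeasurableSet B') (hBB' : Q B = Q B') {X : Ω → ℝ}
    (hX : Measurable X) :
    ∃ X' : Ω → ℝ, Measurable X' ∧ (Q.restrict B').map X' = (Q.restrict B).map X := by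
  rcases eq_or_ne (Q B) 0 with h0 | h0
  · refine ⟨0, measurable_zero, ?_⟩
    rw [Measure.restrict_eq_zero.2 h0, Measure.restrict_eq_zero.2 (hBB' ▸ h0)]
    simp
  have hpos : 0 < Q.real B := (ENNReal.toReal_pos h0 (measure_ne_top _ _))
  obtain ⟨A, hA1, hA2, hA3, hA4⟩ := hQ.exists_chain hB'
  have hreal : Q.real B' = Q.real B := by rw [measureReal_def, measureReal_def, hBB']
  let F : ℚ → ℝ := fun q => Q.real (B ∩ {ω | X ω ≤ q}) / Q.real B
  have hXmono : Monotone fun q : ℚ => B ∩ {ω | X ω ≤ q} := fun q r hqr => by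
    refine Set.inter_subset_inter_right _ fun ω hω => ?_
    have h1 : X ω ≤ q := hω
    have h2 : (q : ℝ) ≤ r := by exact_mod_cast hqr
    exact h1.trans h2
  have hFmono : Monotone F := fun q r hqr =>
    div_le_div_of_nonneg_right (measureReal_mono (hXmono hqr)) hpos.le
  have hAF : ∀ q, Q (A (F q)) = Q (B ∩ {ω | X ω ≤ q}) := fun q => by
    rw [← ENNReal.toReal_eq_toReal_iff' (measure_ne_top _ _) (measure_ne_top _ _)]
    change Q.real _ = Q.real _
    rw [hA4 _ (by positivity) (div_le_one_of_le₀ (measureReal_mono Set.inter_subset_left) hpos.le),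
      hreal, div_mul_cancel₀ _ hpos.ne']
  classical
  -- This is a quantile transform, with the chain `A` in the role of a uniform variable and `F` the
  -- conditional distribution function of `X` on `B`. Rational levels keep it measurable; infinite
  -- values are allowed until the laws have been compared.
  let Y : Ω → EReal := fun ω => ⨅ q : ℚ, if ω ∈ A (F q) then ((q : ℝ) : EReal) else ⊤
  have hY : ∀ t : EReal, Y ⁻¹' Set.Iio t = ⋃ q : {q : ℚ // ((q : ℝ) : EReal) < t}, A (F q) := by
    intro t
    ext ω
    simp only [Y, Set.mem_preimage, Set.mem_Iio, iInf_lt_iff, Set.mem_iUnion, Subtype.exists,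
      exists_prop]
    refine exists_congr fun q => ?_
    split_ifs with h <;> simp [h]
  have hYm : Measurable Y := measurable_of_Iio fun t => by
    rw [hY]
    exact MeasurableSet.iUnion fun q => hA1 _
  have hXY : (Q.restrict B').map Y = (Q.restrict B).map (fun ω => ((X ω : ℝ) : EReal)) := by
    have hXm : Measurable (fun ω => ((X ω : ℝ) : EReal)) := hX.coe_real_ereal
    refine ext_of_generate_finite _ (BorelSpace.measurable_eq.trans
      (borel_eq_generateFrom_Iio EReal)) isPiSystem_Iio ?_ ?_
    · rintro _ ⟨t, rfl⟩
      have hXt : (fun ω => ((X ω : ℝ) : EReal)) ⁻¹' Set.Iio t ∩ B =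
          ⋃ q : {q : ℚ // ((q : ℝ) : EReal) < t}, B ∩ {ω | X ω ≤ (q : ℚ)} := by
        ext ω
        simp only [Set.mem_inter_iff, Set.mem_preimage, Set.mem_Iio, Set.mem_iUnion]
        constructor
        · rintro ⟨h1, h2⟩
          obtain ⟨q, hq1, hq2⟩ := EReal.lt_iff_exists_rat_btwn.1 h1
          exact ⟨⟨q, hq2⟩, h2, (EReal.coe_lt_coe_iff.1 hq1).le⟩
        · rintro ⟨⟨q, hq⟩, h2, h1⟩
          exact ⟨(EReal.coe_le_coe_iff.2 h1).trans_lt hq, h2⟩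
      rw [Measure.map_apply hYm measurableSet_Iio, Measure.map_apply hXm measurableSet_Iio,
        Measure.restrict_apply (hYm measurableSet_Iio),
        Measure.restrict_apply (hXm measurableSet_Iio), hXt, hY,
        Set.inter_eq_left.2 (Set.iUnion_subset fun q => hA2 _)]
      have hm1 : Monotone fun q : {q : ℚ // ((q : ℝ) : EReal) < t} => A (F q) :=
        fun q r hqr => hA3 (hFmono hqr)
      have hm2 : Monotone fun q : {q : ℚ // ((q : ℝ) : EReal) < t} => B ∩ {ω | X ω ≤ (q : ℚ)} :=
        fun q r hqr => hXmono hqr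
      rw [Directed.measure_iUnion hm1.directed_le, Directed.measure_iUnion hm2.directed_le]
      simp only [hAF]
    · rw [Measure.map_apply hYm .univ, Measure.map_apply hXm .univ]
      simp [hBB']
  refine ⟨fun ω => (Y ω).toReal, hYm.ereal_toReal, ?_⟩
  have h1 := congrArg (Measure.map EReal.toReal) hXY
  rw [Measure.map_map measurable_ereal_toReal hYm,
    Measure.map_map measurable_ereal_toReal hX.coe_real_ereal] at h1
  exact h1

/-- In an atomless space, a copy of a discrete random variable extends to a copy of any pair that
contains this variable. -/
theorem IsDivisible.exists_identDistrib_prodMk (hQ : IsDivisible Q) {N N' : Ω → ℤ}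
    (hN : Measurable N) (hN' : Measurable N') (hNN' : Q.map N = Q.map N') {X : Ω → ℝ}
    (hX : Measurable X) :
    ∃ X' : Ω → ℝ, Measurable X' ∧
      IdentDistrib (fun ω => (N' ω, X' ω)) (fun ω => (N ω, X ω)) Q Q := by
  have h : ∀ i : ℤ, ∃ X' : Ω → ℝ, Measurable X' ∧
      (Q.restrict (N' ⁻¹' {i})).map X' = (Q.restrict (N ⁻¹' {i})).map X := by
    intro i
    have hi := measurableSet_singleton i
    refine hQ.exists_map_restrict_eq (hN' hi) ?_ hX
    rw [← Measure.map_apply hN hi, ← Measure.map_apply hN' hi, hNN']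
  choose Y hYm hY using h
  have hYm' : Measurable fun ω => Y (N' ω) ω :=
    (measurable_from_prod_countable_right (f := fun p : ℤ × Ω => Y p.1 p.2) hYm).comp
      (hN'.prodMk measurable_id)
  refine ⟨fun ω => Y (N' ω) ω, hYm', (hN'.prodMk hYm').aemeasurable,
    (hN.prodMk hX).aemeasurable, ?_⟩
  rw [map_prodMk_eq_sum hN' hYm', map_prodMk_eq_sum hN hX]
  congr 1
  funext i
  rw [← hY i]
  congr 1
  refine Measure.map_congr ?_
  filter_upwards [ae_restrict_mem (hN' (measurableSet_singleton i))] with ω hω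
  have : N' ω = i := hω
  simp [this]

/-- In an atomless space, if `A'` is a copy of `A`, then there is a copy `B'` of `B` such that
`E[A' B']` is almost as large as `E[A B]`. -/
theorem IsDivisible.exists_identDistrib_integral_mul_ge (hQ : IsDivisible Q) {A A' B : Ω → ℝ}
    (hA : Measurable A) (hA' : Measurable A') (hB : Measurable B) (hAA' : Q.map A = Q.map A')
    (hBi : Integrable B Q) (hAB : Integrable (fun ω => A ω * B ω) Q) {ε : ℝ} (hε : 0 < ε) :
    ∃ B' : Ω → ℝ, Measurable B' ∧ IdentDistrib B' B Q Q ∧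
      ∫ ω, A ω * B ω ∂Q - ε ≤ ∫ ω, A' ω * B' ω ∂Q := by
  set I := ∫ ω, |B ω| ∂Q with hI
  have hI0 : 0 ≤ I := integral_nonneg fun ω => abs_nonneg _
  -- Rounding costs at most `δ * I` in each of the two integrals; the `+ 1` covers `I = 0`.
  set δ : ℝ := ε / (2 * (I + 1)) with hδdef
  have hδ : 0 < δ := by positivity
  have hδI : 2 * (δ * I) ≤ ε := by
    have : δ * (2 * (I + 1)) = ε := div_mul_cancel₀ _ (by positivity)
    nlinarith
  have hfl : Measurable fun a : ℝ => ⌊a / δ⌋ := (measurable_id.div_const δ).floor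
  have hNN' : Q.map (fun ω => ⌊A ω / δ⌋) = Q.map (fun ω => ⌊A' ω / δ⌋) := by
    have := congrArg (Measure.map fun a : ℝ => ⌊a / δ⌋) hAA'
    rwa [Measure.map_map hfl hA, Measure.map_map hfl hA'] at this
  -- Only the pair with the rounded variable is copied exactly.
  obtain ⟨B', hB', hid⟩ :=
    hQ.exists_identDistrib_prodMk (hfl.comp hA) (hfl.comp hA') hNN' hB
  have hBB' : IdentDistrib B' B Q Q := hid.comp measurable_snd
  have hprod : IdentDistrib (fun ω => (⌊A' ω / δ⌋ : ℝ) * B' ω) (fun ω => (⌊A ω / δ⌋ : ℝ) * B ω)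
      Q Q := hid.comp (u := fun p : ℤ × ℝ => (p.1 : ℝ) * p.2)
        ((measurable_from_top.comp measurable_fst).mul measurable_snd)
  have hB'i : Integrable B' Q := hBB'.integrable_iff.2 hBi
  have hI' : ∫ ω, |B' ω| ∂Q = I := (hBB'.comp (measurable_norm (α := ℝ))).integral_eq
  have hr := integrable_sub_mul_floor_mul hδ hA hBi
  have hr' := integrable_sub_mul_floor_mul hδ hA' hB'i
  have hNB : Integrable (fun ω => (⌊A ω / δ⌋ : ℝ) * B ω) Q := by
    refine ((hAB.sub hr).const_mul δ⁻¹).congr (Eventually.of_forall fun ω => ?_)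
    simp only [Pi.sub_apply]
    field_simp
    ring
  have hNB' := hprod.integrable_iff.2 hNB
  have key : ∀ {C D : Ω → ℝ}, Integrable (fun ω => (C ω - δ * ⌊C ω / δ⌋) * D ω) Q →
      Integrable (fun ω => (⌊C ω / δ⌋ : ℝ) * D ω) Q →
      ∫ ω, C ω * D ω ∂Q = ∫ ω, (C ω - δ * ⌊C ω / δ⌋) * D ω ∂Q +
        δ * ∫ ω, (⌊C ω / δ⌋ : ℝ) * D ω ∂Q := by
    intro C D h1 h2
    rw [← integral_const_mul, ← integral_add h1 (h2.const_mul δ)]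
    refine integral_congr_ae (Eventually.of_forall fun ω => ?_)
    simp only
    ring
  refine ⟨B', hB', hBB', ?_⟩
  rw [key hr hNB, key hr' hNB', hprod.integral_eq]
  have e1 := abs_le.1 (abs_integral_sub_mul_floor_mul_le hδ (A := A) hBi)
  have e2 := abs_le.1 (abs_integral_sub_mul_floor_mul_le hδ (A := A') hB'i)
  rw [hI'] at e2
  rw [← hI] at e1
  linarith [e1.2, e2.1]

end Divisible

section LawInvariance

variable {Ω : Type*} {G mΩ : MeasurableSpace Ω} {P : Measure Ω} {hG : G ≤ mΩ}

/-! ### Copies of random variables over an atomless sub-σ-algebra -/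

theorem Atomless.isDivisible_trim (hatom : Atomless G P) (hG : G ≤ mΩ) :
    IsDivisible (P.trim hG) := by
  intro B hB p hp
  rw [trim_measurableSet_eq hG hB] at hp
  have h : p ∈ Set.Icc 0 (P B) := ⟨zero_le, hp⟩
  rw [← hatom B hB] at h
  obtain ⟨A, hAB, hA, hAp⟩ := h
  exact ⟨A, hAB, hA, by rw [trim_measurableSet_eq hG hA, hAp]⟩

theorem map_trim_eq (hG : G ≤ mΩ) {f : Ω → ℝ} (hf : Measurable[G] f) :
    @Measure.map Ω ℝ G _ f (P.trim hG) = P.map f := by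
  ext s hs
  rw [Measure.map_apply hf hs, Measure.map_apply (hf.mono hG le_rfl) hs,
    trim_measurableSet_eq hG (hf hs)]

/-- If `f'` is a copy of `f` over an atomless sub-σ-algebra, then there is a copy `g'` of `g` such
that `E[f' g']` is almost as large as `E[f g]`. -/
theorem Atomless.exists_identDistrib_integral_mul_ge [IsProbabilityMeasure P]
    (hatom : Atomless G P) (hG : G ≤ mΩ) {f f' g : Ω → ℝ} (hf : AEStronglyMeasurable[G] f P)
    (hf' : AEStronglyMeasurable[G] f' P) (hg : AEStronglyMeasurable[G] g P)
    (hff' : IdentDistrib f f' P P) (hgi : Integrable g P)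
    (hfg : Integrable (fun ω => f ω * g ω) P) {ε : ℝ} (hε : 0 < ε) :
    ∃ g' : Ω → ℝ, StronglyMeasurable[G] g' ∧ IdentDistrib g' g P P ∧
      ∫ ω, f ω * g ω ∂P - ε ≤ ∫ ω, f' ω * g' ω ∂P := by
  have hA := hf.stronglyMeasurable_mk
  have hA' := hf'.stronglyMeasurable_mk
  have hB := hg.stronglyMeasurable_mk
  have hprod : (fun ω => f ω * g ω) =ᵐ[P] fun ω => hf.mk f ω * hg.mk g ω := by
    filter_upwards [hf.ae_eq_mk, hg.ae_eq_mk] with ω h1 h2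
    rw [h1, h2]
  have hlaw : @Measure.map Ω ℝ G _ (hf.mk f) (P.trim hG) =
      @Measure.map Ω ℝ G _ (hf'.mk f') (P.trim hG) := by
    rw [map_trim_eq hG hA.measurable, map_trim_eq hG hA'.measurable,
      ← Measure.map_congr hf.ae_eq_mk, ← Measure.map_congr hf'.ae_eq_mk]
    exact hff'.map_eq
  obtain ⟨g', hg', ⟨-, -, hmap⟩, hle⟩ :=
    (hatom.isDivisible_trim hG).exists_identDistrib_integral_mul_ge hA.measurable hA'.measurable
      hB.measurable hlaw ((hgi.congr hg.ae_eq_mk).trim hG hB)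
      ((hfg.congr hprod).trim hG (hA.mul hB)) hε
  have hg's : StronglyMeasurable[G] g' := hg'.stronglyMeasurable
  refine ⟨g', hg's, ⟨(hg'.mono hG le_rfl).aemeasurable, hgi.aemeasurable, ?_⟩, ?_⟩
  · rwa [map_trim_eq hG hg', map_trim_eq hG hB.measurable,
      ← Measure.map_congr hg.ae_eq_mk] at hmap
  · rw [← integral_trim hG (f := fun ω => hf.mk f ω * hg.mk g ω) (hA.mul hB),
      ← integral_trim hG (f := fun ω => hf'.mk f' ω * g' ω) (hA'.mul hg's),
      ← integral_congr_ae hprod] at hle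
    refine hle.trans_eq (integral_congr_ae ?_)
    filter_upwards [hf'.ae_eq_mk] with ω h
    rw [h]

/-! ### The closure of the sublevel sets -/

section Closure

variable {τ : ACProb P hG → Linf P → EReal} {ρ : Linf P → ℝ}

/-- The probability measures with penalty at most `c`. -/
def sublevel (τ : ACProb P hG → Linf P → EReal) (c : ℝ) : Set (ACMeasures P hG) :=
  Subtype.val '' {μ : ACProb P hG | -(τ μ 0) ≤ (c : EReal)}

/-- The functionals `Y ↦ E^μ[Y]` on `L^∞(𝒢)`. -/
def expectMap (μ : ACMeasures P hG) : LinfSub G P → ℝ := fun Y => expect μ (Y : Linf P)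

theorem mem_closure_iff_expectMap {S : Set (ACMeasures P hG)} {ν : ACMeasures P hG} :
    ν ∈ closure[weakTopology P hG] S ↔ expectMap ν ∈ closure (expectMap '' S) :=
  closure_induced

theorem expect_le_of_mem_closure {S : Set (ACMeasures P hG)} {ν : ACMeasures P hG}
    (hν : ν ∈ closure[weakTopology P hG] S) {Y : Linf P} (hY : Y ∈ LinfSub G P) {r : ℝ}
    (h : ∀ μ ∈ S, expect μ Y ≤ r) : expect ν Y ≤ r := by
  rw [mem_closure_iff_expectMap] at hν
  have hcl : IsClosed {x : LinfSub G P → ℝ | x ⟨Y, hY⟩ ≤ r} :=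
    isClosed_le (continuous_apply _) continuous_const
  refine closure_minimal ?_ hcl hν
  rintro _ ⟨μ, hμ, rfl⟩
  exact h μ hμ

theorem IsRealConvexAdjustment.eq_zero {μ : ACMeasures P hG} {t : Linf P → ℝ}
    (ht : IsRealConvexAdjustment μ t) {Y : Linf P} (hY : Y ∈ LinfSub G P) : t Y = t 0 := by
  simpa using ht.invariant 0 Y hY

theorem expect_zero (μ : ACMeasures P hG) : expect μ 0 = 0 := by
  rw [expect_eq_pairing, map_zero]

theorem expect_smul (μ : ACMeasures P hG) (a : ℝ) (X : Linf P) :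
    expect μ (a • X) = a * expect μ X := by
  rw [expect_eq_pairing, expect_eq_pairing, map_smul, smul_eq_mul]

/-- On L^∞(𝒢) the adjustment keeps its value at 0, which is at least `-c`; this is the easy half of
the conjugate duality. -/
theorem expect_le_of_mem_sublevel (hrep : Represents τ ρ) (hτ : IsCoAAssignment τ) {c : ℝ}
    {μ : ACMeasures P hG} (hμ : μ ∈ sublevel τ c) {Y : Linf P} (hY : Y ∈ LinfSub G P) :
    expect μ Y ≤ ρ Y + c := by
  obtain ⟨μ, hμc, rfl⟩ := hμ
  rcases hτ.adjustment μ with ⟨t, ht, hτt⟩ | hbot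
  · have h1 := hrep.le μ hτt Y
    rw [ht.eq_zero hY] at h1
    have h2 : -t 0 ≤ c := by
      rw [Set.mem_ofPred_eq, hτt] at hμc
      exact_mod_cast hμc
    linarith
  · simp [hbot] at hμc

/-- Every continuous functional on `ℝ^(L^∞(𝒢))` acts on measures as an element of `L^∞(𝒢)`. -/
theorem exists_expect_eq_of_dual (φ : (LinfSub G P → ℝ) →L[ℝ] ℝ) :
    ∃ Y ∈ LinfSub G P, ∀ μ : ACMeasures P hG, φ (expectMap μ) = expect μ Y := by
  -- A continuous functional on a product of lines is a finite combination of coordinates.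
  suffices h : ∀ x ∈ Submodule.span ℝ (Set.range fun Y : LinfSub G P =>
      (LinearMap.proj Y : (LinfSub G P → ℝ) →ₗ[ℝ] ℝ)),
      ∃ Y ∈ LinfSub G P, ∀ μ : ACMeasures P hG, x (expectMap μ) = expect μ Y from
    h (φ : (LinfSub G P → ℝ) →ₗ[ℝ] ℝ) ((LinearMap.mem_span_iff_continuous _).2 φ.continuous)
  intro x hx
  induction hx using Submodule.span_induction with
  | mem x hx =>
    obtain ⟨Y, rfl⟩ := hx
    exact ⟨Y, Y.2, fun μ => rfl⟩
  | zero => exact ⟨0, Submodule.zero_mem _, fun μ => by rw [expect_zero, LinearMap.zero_apply]⟩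
  | add x y _ _ hx hy =>
    obtain ⟨X, hX, hX'⟩ := hx
    obtain ⟨Y, hY, hY'⟩ := hy
    refine ⟨X + Y, Submodule.add_mem _ hX hY, fun μ => ?_⟩
    rw [LinearMap.add_apply, hX', hY', expect_eq_pairing, expect_eq_pairing, expect_eq_pairing,
      map_add]
  | smul a x _ hx =>
    obtain ⟨X, hX, hX'⟩ := hx
    exact ⟨a • X, Submodule.smul_mem _ a hX, fun μ => by
      rw [LinearMap.smul_apply, hX', expect_smul, smul_eq_mul]⟩

/-- The epigraph of the penalty function, seen in `ℝ^(L^∞(𝒢)) × ℝ`. -/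
def penaltyEpigraph (τ : ACProb P hG → Linf P → EReal) : Set ((LinfSub G P → ℝ) × ℝ) :=
  {p | ∃ μ : ACProb P hG, expectMap (μ : ACMeasures P hG) = p.1 ∧
    ((-p.2 : ℝ) : EReal) ≤ τ μ 0}

theorem Represents.exists_neg_lt (hrep : Represents τ ρ) {c : ℝ} (hc : -ρ 0 < c) :
    ∃ μ : ACProb P hG, ((-c : ℝ) : EReal) < τ μ 0 := by
  have h : ((-c : ℝ) : EReal) < ((ρ 0 : ℝ) : EReal) := EReal.coe_lt_coe_iff.2 (by linarith)
  rw [hrep 0, lt_iSup_iff] at h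
  obtain ⟨μ, hμ⟩ := h
  rw [expect_zero, EReal.coe_zero, zero_add] at hμ
  exact ⟨μ, hμ⟩

variable [IsProbabilityMeasure P]

/-- This is where concavity of μ ↦ τ_μ(0) enters. -/
theorem convex_penaltyEpigraph (hτ : IsCoAAssignment τ) : Convex ℝ (penaltyEpigraph τ) := by
  rintro ⟨x, r⟩ ⟨μ, hμx, hμr⟩ ⟨y, s⟩ ⟨ν, hνy, hνs⟩ a b ha hb hab
  obtain rfl : b = 1 - a := by linarith
  obtain rfl : expectMap (μ : ACMeasures P hG) = x := hμx
  obtain rfl : expectMap (ν : ACMeasures P hG) = y := hνy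
  have ha1 : a ≤ 1 := by linarith
  refine ⟨⟨_, ACProb.combination_mem μ.2 ν.2 ha ha1⟩, ?_, ?_⟩
  · funext Y
    simp only [expectMap, expect_combination, Prod.fst_add, Prod.smul_fst,
      Pi.add_apply, Pi.smul_apply, smul_eq_mul]
  · refine le_trans ?_ (hτ.concave μ ν _ a ha ha1 rfl)
    have h1 := mul_le_mul_of_nonneg_left hμr (EReal.coe_nonneg.2 ha)
    have h2 := mul_le_mul_of_nonneg_left hνs (EReal.coe_nonneg.2 hb)
    refine le_trans (le_of_eq ?_) (add_le_add h1 h2)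
    rw [← EReal.coe_mul, ← EReal.coe_mul, ← EReal.coe_add, EReal.coe_eq_coe_iff]
    simp only [Prod.snd_add, Prod.smul_snd, smul_eq_mul]
    ring

/-- A measure whose conjugate penalty is at most `c` lies, at height `c`, in the closure of the
epigraph of the penalty function. -/
theorem mem_closure_penaltyEpigraph (hrep : Represents τ ρ) (hτ : IsCoAAssignment τ) {c : ℝ}
    (hc : -ρ 0 < c) {ν : ACMeasures P hG} (hν : ∀ Y ∈ LinfSub G P, expect ν Y ≤ ρ Y + c) :
    (expectMap ν, c) ∈ closure (penaltyEpigraph τ) := by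
  by_contra hcon
  obtain ⟨ψ, u, hψ1, hψ2⟩ := geometric_hahn_banach_closed_point
    (convex_penaltyEpigraph hτ).closure isClosed_closure hcon
  obtain ⟨Y, hY, hφY⟩ := exists_expect_eq_of_dual (hG := hG)
    (ψ.comp (ContinuousLinearMap.inl ℝ (LinfSub G P → ℝ) ℝ))
  set b := ψ (0, 1) with hb
  have hψ : ∀ (μ : ACMeasures P hG) (s : ℝ), ψ (expectMap μ, s) = expect μ Y + b * s := by
    intro μ s
    have h1 : ((expectMap μ, s) : (LinfSub G P → ℝ) × ℝ) =
        ContinuousLinearMap.inl ℝ (LinfSub G P → ℝ) ℝ (expectMap μ) + s • (0, 1) := by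
      simp
    rw [h1, map_add, map_smul, ← hφY μ, smul_eq_mul, mul_comm b]
    rfl
  have hlt : ∀ (μ : ACProb P hG) (s : ℝ), ((-s : ℝ) : EReal) ≤ τ μ 0 →
      expect (μ : ACMeasures P hG) Y + b * s < u := fun μ s hs => by
    rw [← hψ]
    exact hψ1 _ (subset_closure ⟨μ, rfl, hs⟩)
  rw [hψ] at hψ2
  obtain ⟨μ₀, hμ₀⟩ := hrep.exists_neg_lt hc
  -- The epigraph is unbounded upwards, so the separating functional cannot increase with height.
  have hb0 : 0 ≤ -b := by
    refine nonneg_of_forall_nat_mul_le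
      (K := u - expect (μ₀ : ACMeasures P hG) Y - b * c) fun n => ?_
    have := hlt μ₀ (c + n) ((EReal.coe_le_coe_iff.2 (by
      have : (0 : ℝ) ≤ n := Nat.cast_nonneg n
      linarith)).trans hμ₀.le)
    linarith
  -- For a vertical hyperplane, growth along the multiples `n • Y` already contradicts the bound on
  -- `ν`; otherwise `Y` is rescaled by `(-b)⁻¹`.
  rcases hb0.eq_or_lt with hb0 | hb0
  · have hb0' : b = 0 := by linarith
    rw [hb0'] at hlt hψ2
    have h1 : ∀ n : ℕ, ρ ((n : ℝ) • Y) ≤ n * u + ρ 0 := fun n =>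
      hrep.le_of_forall hτ fun μ t ht hτt => by
        have h2 := hlt μ (-t 0) (by rw [neg_neg, hτt])
        have h3 := hrep.le μ hτt 0
        rw [expect_zero] at h3
        rw [expect_smul, ht.eq_zero (Submodule.smul_mem _ _ hY)]
        have h4 := mul_le_mul_of_nonneg_left h2.le (Nat.cast_nonneg (α := ℝ) n)
        linarith
    have h5 : 0 ≤ u - expect ν Y := by
      refine nonneg_of_forall_nat_mul_le (K := ρ 0 + c) fun n => ?_
      have h6 := hν _ (Submodule.smul_mem _ (n : ℝ) hY)
      rw [expect_smul] at h6
      linarith [h1 n]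
    linarith
  · have hY' := Submodule.smul_mem (LinfSub G P) (-b)⁻¹ hY
    have h1 : ρ ((-b)⁻¹ • Y) ≤ (-b)⁻¹ * u := hrep.le_of_forall hτ fun μ t ht hτt => by
      have h2 := hlt μ (-t 0) (by rw [neg_neg, hτt])
      rw [expect_smul, ht.eq_zero hY']
      have h3 : (-b)⁻¹ * (expect (μ : ACMeasures P hG) Y + b * -t 0) ≤ (-b)⁻¹ * u :=
        mul_le_mul_of_nonneg_left h2.le (inv_nonneg.2 hb0.le)
      have h4 : (-b)⁻¹ * (expect (μ : ACMeasures P hG) Y + b * -t 0) =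
          (-b)⁻¹ * expect (μ : ACMeasures P hG) Y + t 0 := by
        rw [mul_add, show b * -t 0 = -b * t 0 by ring, inv_mul_cancel_left₀ hb0.ne']
      linarith
    have h5 := hν _ hY'
    rw [expect_smul] at h5
    have h6 : (-b)⁻¹ * (expect ν Y - u) ≤ c := by linarith
    rw [inv_mul_le_iff₀ hb0] at h6
    linarith

/-- The closure of a sublevel set of the penalty function, strictly above its infimum, contains the
sublevel set of the conjugate of `ρ`. -/
theorem mem_closure_sublevel (hrep : Represents τ ρ) (hτ : IsCoAAssignment τ) {c : ℝ}
    (hc : -ρ 0 < c) {ν : ACMeasures P hG} (hν : ∀ Y ∈ LinfSub G P, expect ν Y ≤ ρ Y + c) :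
    ν ∈ closure[weakTopology P hG] (sublevel τ c) := by
  rw [mem_closure_iff_expectMap]
  have hmem := mem_closure_penaltyEpigraph hrep hτ hc hν
  obtain ⟨μ₀, hμ₀⟩ := hrep.exists_neg_lt hc
  obtain ⟨s₀, hs₀, hs₀'⟩ := EReal.lt_iff_exists_real_btwn.1 hμ₀
  have hs₀c : -s₀ < c := by
    have := EReal.coe_lt_coe_iff.1 hs₀
    linarith
  have hmem₀ : (expectMap (μ₀ : ACMeasures P hG), -s₀) ∈ closure (penaltyEpigraph τ) :=
    subset_closure ⟨μ₀, rfl, by simpa using hs₀'.le⟩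
  -- Height below `c` is an open condition, so such limit points are approached from within the
  -- sublevel set. Height exactly `c` is reached along a segment towards `μ₀`, which exists because
  -- `c > -ρ 0`.
  have hstrict : ∀ p ∈ closure (penaltyEpigraph τ), p.2 < c →
      p.1 ∈ closure (expectMap '' sublevel τ c) := by
    intro p hp hpc
    have hopen : IsOpen {p : (LinfSub G P → ℝ) × ℝ | p.2 < c} :=
      isOpen_lt continuous_snd continuous_const
    have h1 := hopen.inter_closure ⟨hpc, hp⟩
    refine map_mem_closure continuous_fst h1 ?_
    rintro ⟨x, s⟩ ⟨hs, μ, hμx, hμs⟩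
    refine ⟨μ, ⟨μ, ?_, rfl⟩, hμx⟩
    have hsc : s < c := hs
    rw [Set.mem_ofPred_eq, EReal.neg_le]
    exact (EReal.coe_le_coe_iff.2 (by linarith : -c ≤ -s)).trans hμs
  have hlim : Tendsto (fun ε : ℝ => (1 - ε) • expectMap ν + ε • expectMap (μ₀ : ACMeasures P hG))
      (𝓝[>] 0) (𝓝 (expectMap ν)) := by
    have : Continuous fun ε : ℝ =>
        (1 - ε) • expectMap ν + ε • expectMap (μ₀ : ACMeasures P hG) := by fun_prop
    have h2 := this.tendsto 0
    simp only [sub_zero, one_smul, zero_smul, add_zero] at h2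
    exact h2.mono_left nhdsWithin_le_nhds
  refine isClosed_closure.mem_of_tendsto hlim ?_
  filter_upwards [Ioo_mem_nhdsGT (zero_lt_one (α := ℝ))] with ε hε
  have h3 := (convex_penaltyEpigraph hτ).closure hmem hmem₀ (sub_nonneg.2 hε.2.le) hε.1.le
    (sub_add_cancel 1 ε)
  refine hstrict _ h3 ?_
  simp only [Prod.snd_add, Prod.smul_snd, smul_eq_mul]
  nlinarith [hε.1]

end Closure

/-! ### The characterization of law invariance -/

section Characterization

variable {τ : ACProb P hG → Linf P → EReal} {ρ : Linf P → ℝ}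

theorem aestronglyMeasurable_of_mem_linfSub {X : Linf P} (hX : X ∈ LinfSub G P) :
    AEStronglyMeasurable[G] X P := mem_lpMeas_iff_aestronglyMeasurable.1 hX

theorem integrable_mul_linf {f : Ω → ℝ} (hf : Integrable f P) (X : Linf P) :
    Integrable (fun ω => f ω * X ω) P :=
  hf.mul_of_top_left (Lp.memLp X)

theorem coeFn_densityClass (μ : ACMeasures P hG) : densityClass μ =ᵐ[P] density μ :=
  AEEqFun.coeFn_mk _ _

variable [IsProbabilityMeasure P]

/-- If `f` has the law of the density of `μ`, then `E[f Y]` is bounded by any law invariant bound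
for `E^μ`. -/
theorem Atomless.integral_mul_le_of_identDistrib (hatom : Atomless G P) (hρ : LawInvariant G ρ)
    {μ : ACMeasures P hG} {c : ℝ} (hμ : ∀ W ∈ LinfSub G P, expect μ W ≤ ρ W + c) {f : Ω → ℝ}
    (hf : AEStronglyMeasurable[G] f P) (hid : IdentDistrib (density μ) f P P) {Y : Linf P}
    (hY : Y ∈ LinfSub G P) : ∫ ω, f ω * Y ω ∂P ≤ ρ Y + c := by
  have hfi : Integrable f P := hid.integrable_iff.1 (integrable_density μ)
  refine le_of_forall_pos_le_add fun ε hε => ?_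
  -- Instead of moving the density, `Y` is moved to a copy `g`, on which ρ takes the same value.
  obtain ⟨g, hgm, hg, hle⟩ := hatom.exists_identDistrib_integral_mul_ge hG hf
    (stronglyMeasurable_density μ).aestronglyMeasurable (aestronglyMeasurable_of_mem_linfSub hY)
    hid.symm (integrable_linf Y) (integrable_mul_linf hfi Y) hε
  have hgtop : MemLp g ⊤ P := hg.memLp_iff.2 (Lp.memLp Y)
  have hcoe : hgtop.toLp g =ᵐ[P] g := MemLp.coeFn_toLp hgtop
  have hW : hgtop.toLp g ∈ LinfSub G P := by
    rw [mem_lpMeas_iff_aestronglyMeasurable]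
    exact hgm.aestronglyMeasurable.congr hcoe.symm
  have h1 := hμ _ hW
  have h2 : expect μ (hgtop.toLp g) = ∫ ω, density μ ω * g ω ∂P := by
    refine integral_congr_ae ?_
    filter_upwards [hcoe] with ω hω
    rw [hω]
  have h3 : ρ (hgtop.toLp g) = ρ Y := hρ _ hW _ hY
    ((IdentDistrib.of_ae_eq (Lp.aestronglyMeasurable _).aemeasurable hcoe).trans hg)
  linarith

/-- The closure consists of the ν with E^ν ≤ ρ + c on L^∞(𝒢), a condition that passes to measures
whose density has the same law. -/
theorem almostLawInvariant_sublevel (hatom : Atomless G P) (hrep : Represents τ ρ)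
    (hτ : IsCoAAssignment τ) (hρ : LawInvariant G ρ) {c : ℝ} (hc : -ρ 0 < c) :
    AlmostLawInvariant (sublevel τ c) := by
  rintro _ ⟨μ, hμ, rfl⟩ - Y hY hid
  have hid' : IdentDistrib (density μ) Y P P :=
    (IdentDistrib.of_ae_eq (aestronglyMeasurable_density μ).aemeasurable
      (coeFn_densityClass μ).symm).trans hid
  have hYi : Integrable Y P := hid'.integrable_iff.1 (integrable_density μ)
  have hd : density (ofDensity P hG (hY.mk Y)) =ᵐ[P] Y :=
    (density_ofDensity (hYi.congr hY.ae_eq_mk) hY.stronglyMeasurable_mk).trans hY.ae_eq_mk.symm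
  refine ⟨ofDensity P hG (hY.mk Y), mem_closure_sublevel hrep hτ hc fun W hW => ?_,
    AEEqFun.ext ((coeFn_densityClass _).trans hd)⟩
  have h1 : expect (ofDensity P hG (hY.mk Y)) W = ∫ ω, Y ω * W ω ∂P := by
    refine integral_congr_ae ?_
    filter_upwards [hd] with ω hω
    rw [hω]
  rw [h1]
  exact hatom.integral_mul_le_of_identDistrib hρ (fun V hV => expect_le_of_mem_closure hμ hV
    fun κ hκ => expect_le_of_mem_sublevel hrep hτ hκ hV) hY hid' hW

theorem lawInvariant_of_almostLawInvariant (hatom : Atomless G P) (hrep : Represents τ ρ)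
    (hτ : IsCoAAssignment τ)
    (h : ∀ c : ℝ, -ρ 0 < c → AlmostLawInvariant (sublevel τ c)) : LawInvariant G ρ := by
  have key : ∀ X ∈ LinfSub G P, ∀ Y ∈ LinfSub G P, IdentDistrib X Y P P → ρ X ≤ ρ Y := by
    intro X hX Y hY hXY
    refine le_of_forall_pos_le_add fun ε hε => hrep.le_of_forall hτ fun μ t ht hτt => ?_
    rw [ht.eq_zero hX]
    -- The level `-t 0` itself may equal `-ρ 0`; half of `ε` makes it admissible, the other half
    -- pays for the copy of the density.
    have hc : -ρ 0 < -t 0 + ε / 2 := by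
      have := hrep.le μ hτt 0
      rw [expect_zero] at this
      linarith
    have hμ : (μ : ACMeasures P hG) ∈ sublevel τ (-t 0 + ε / 2) := by
      refine ⟨μ, ?_, rfl⟩
      rw [Set.mem_ofPred_eq, hτt, ← EReal.coe_neg, EReal.coe_le_coe_iff]
      linarith
    obtain ⟨g, hgm, hg, hle⟩ := hatom.exists_identDistrib_integral_mul_ge hG
      (aestronglyMeasurable_of_mem_linfSub hX) (aestronglyMeasurable_of_mem_linfSub hY)
      (stronglyMeasurable_density (μ : ACMeasures P hG)).aestronglyMeasurable hXY
      (integrable_density _)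
      ((integrable_mul_linf (integrable_density (μ : ACMeasures P hG)) X).congr
        (Eventually.of_forall fun ω => mul_comm _ _)) (half_pos hε)
    have hgm' : AEStronglyMeasurable g P := (hgm.mono hG).aestronglyMeasurable
    have hcoe : AEEqFun.mk g hgm' =ᵐ[P] g := AEEqFun.coeFn_mk _ _
    obtain ⟨ν, hν, hνg⟩ := h _ hc (densityClass (μ : ACMeasures P hG))
      ⟨μ, (mem_closure_iff_expectMap.2 (subset_closure ⟨μ, hμ, rfl⟩)), rfl⟩
      ((stronglyMeasurable_density _).aestronglyMeasurable.congr (coeFn_densityClass _).symm)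
      (AEEqFun.mk g hgm') (hgm.aestronglyMeasurable.congr hcoe.symm)
      (((IdentDistrib.of_ae_eq (AEEqFun.aestronglyMeasurable _).aemeasurable
        (coeFn_densityClass _)).trans hg.symm).trans
        (IdentDistrib.of_ae_eq hgm'.aemeasurable hcoe.symm))
    have hνd : density ν =ᵐ[P] g := by
      refine (coeFn_densityClass ν).symm.trans ?_
      rw [hνg]
      exact hcoe
    have h1 : expect ν Y ≤ ρ Y + (-t 0 + ε / 2) := expect_le_of_mem_closure hν hY
      fun κ hκ => expect_le_of_mem_sublevel hrep hτ hκ hY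
    have h2 : expect ν Y = ∫ ω, Y ω * g ω ∂P := by
      refine integral_congr_ae ?_
      filter_upwards [hνd] with ω hω
      rw [hω, mul_comm]
    have h3 : expect (μ : ACMeasures P hG) X =
        ∫ ω, X ω * density (μ : ACMeasures P hG) ω ∂P :=
      integral_congr_ae (Eventually.of_forall fun ω => mul_comm _ _)
    linarith
  exact fun X hX Y hY hXY => le_antisymm (key X hX Y hY hXY) (key Y hY X hX hXY.symm)

end Characterization

end LawInvariance

end PartialLaw

end

/-! ### The representation and the law-invariance criterion -/

theorem theorem5 {Ω : Type*} {G mΩ : MeasurableSpace Ω} (P : Measure Ω) [IsProbabilityMeasure P]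
    (hG : G ≤ mΩ) (hatom : PartialLaw.Atomless G P) (ρ : PartialLaw.Linf P → ℝ) :
    ((PartialLaw.IsConvexRiskMeasure ρ ∧ PartialLaw.Fatou (fun X => ((ρ X : ℝ) : EReal))) ↔
      ∃ τ : PartialLaw.ACProb P hG → PartialLaw.Linf P → EReal,
        PartialLaw.IsCoAAssignment τ ∧ PartialLaw.Represents τ ρ) ∧
    (∀ τ : PartialLaw.ACProb P hG → PartialLaw.Linf P → EReal,
      PartialLaw.IsCoAAssignment τ → PartialLaw.Represents τ ρ →
        (PartialLaw.LawInvariant G ρ ↔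
          ∀ c : ℝ, -ρ 0 < c →
            PartialLaw.AlmostLawInvariant
              (Subtype.val '' {μ : PartialLaw.ACProb P hG | -(τ μ 0) ≤ (c : EReal)}))) := by
  refine ⟨⟨fun ⟨hρ, hF⟩ => ⟨_, PartialLaw.excess_isCoAAssignment hρ,
    PartialLaw.excess_represents hρ hF⟩, fun ⟨τ, hτ, hrep⟩ =>
      ⟨hrep.isConvexRiskMeasure hτ, hrep.fatou hτ⟩⟩, fun τ hτ hrep => ⟨fun hρ c hc => ?_, ?_⟩⟩
  · exact PartialLaw.almostLawInvariant_sublevel hatom hrep hτ hρ hc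
  · exact PartialLaw.lawInvariant_of_almostLawInvariant hatom hrep hτ
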